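/- Let $k$ be a field of characteristic zero such that, for some integer $\ell\ge 2$, $k$ contains all $\ell$-primary roots of unity (i.e. a primitive $\ell^m$-th root of unity for every $m\ge 0$). Let $n,N\ge 0$ be integers, $L=k(x_1,\dots,x_n)$ and $T=(k^\times)^n$. For a monoid $M$ acting on a group $A$ by endomorphisms, let $H^1(M,A)$ be the set of 1-cocycles, i.e. functions $f:M\to A$ with $f_{\sigma\tau}=f_\sigma\cdot\sigma(f_\tau)$, modulo the equivalence relation: $f\sim f'$ if and only if there is $b\in A$ with $f_\sigma=b^{-1}\cdot f'_\sigma\cdot\sigma(b)$ for all $\sigma\in M$. For $\lambda\in\mathrm{Mat}_{n\times n}\mathbb Z$ with $\det\lambda\neq 0$ and $t\in T$ put $(t^\lambda)_j=\prod_i t_i^{\lambda_{ij}}$. Let $\mathrm{Mat}^{\det\neq 0}_{n\times n}\mathbb Z\ltimes T$ be the monoid of pairs $(\lambda,t)$ with product $(\lambda,t)(\lambda',t')=(\lambda\lambda',t^{\lambda'}t')$. It acts on $L$ by the $k$-algebra endomorphisms $(\lambda,t):x_j\mapsto t_j\prod_i x_i^{\lambda_{ij}}$, hence entrywise on $\mathrm{GL}_NL$.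 Let $\mathrm{GL}_n\mathbb Q\ltimes(T\otimes_{\mathbb Z}\mathbb Q)$ be the group defined by the same formula, using the $\mathbb Q$-linear extension to $\mathrm{GL}_n\mathbb Q$ and $T\otimes\mathbb Q$ of the action $t\mapsto t^\lambda$; it acts trivially on $\mathrm{GL}_Nk$. Then restriction along the homomorphism $\mathrm{Mat}^{\det\neq 0}_{n\times n}\mathbb Z\ltimes T\to\mathrm{GL}_n\mathbb Q\ltimes(T\otimes\mathbb Q)$, $(\lambda,t)\mapsto(\lambda,t\otimes 1)$, together with the inclusion $\mathrm{GL}_Nk\subset\mathrm{GL}_NL$, induces a bijection $$H^1(\mathrm{GL}_n\mathbb Q\ltimes(T\otimes\mathbb Q),\mathrm{GL}_Nk)\ \xrightarrow{\ \sim\ }\ H^1(\mathrm{Mat}^{\det\neq 0}_{n\times n}\mathbb Z\ltimes T,\mathrm{GL}_NL).$$ -/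

import Mathlib

open scoped TensorProduct

namespace TorusCohomology

/-! ### First cohomology of a monoid with coefficients in a (nonabelian) group -/

section Cohomology

variable {M : Type*} [Monoid M] {A : Type*} [Group A]

/-- 1-cocycles of a monoid `M` acting on a group `A` through `φ`:
functions with `f (σ τ) = f σ · σ (f τ)`. -/
structure Cocycle (φ : M →* Monoid.End A) where
  toFun : M → A
  map_mul' : ∀ σ τ : M, toFun (σ * τ) = toFun σ * φ σ (toFun τ)

/-- Two 1-cocycles `f`, `f'` are cohomologous when `f σ = b⁻¹ · f' σ · σ b` for one `b`. -/
instance cocycleSetoid (φ : M →* Monoid.End A) : Setoid (Cocycle φ) where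
  r f f' := ∃ b : A, ∀ σ : M, f.toFun σ = b⁻¹ * f'.toFun σ * φ σ b
  iseqv :=
    { refl := fun f => ⟨1, fun σ => by simp⟩
      symm := by
        rintro f f' ⟨b, h⟩
        refine ⟨b⁻¹, fun σ => ?_⟩
        rw [h σ, map_inv]
        group
      trans := by
        rintro f f' f'' ⟨b, h⟩ ⟨c, h'⟩
        refine ⟨c * b, fun σ => ?_⟩
        rw [h σ, h' σ, map_mul]
        group }

/-- `H¹(M, A)`: 1-cocycles up to the cohomology relation. -/
def H1 (φ : M →* Monoid.End A) : Type _ := Quotient (cocycleSetoid φ)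

variable {M' : Type*} [Monoid M'] {A' : Type*} [Group A']

/-- Functoriality of `H¹`: restriction along `α : M' →* M` together with a change of coefficients
`β : A →* A'` that is equivariant for `M'`. -/
def H1.map {φ : M →* Monoid.End A} {φ' : M' →* Monoid.End A'} (α : M' →* M) (β : A →* A')
    (h : ∀ (σ : M') (a : A), β (φ (α σ) a) = φ' σ (β a)) : H1 φ → H1 φ' :=
  Quotient.map
    (fun f =>
      { toFun := fun σ => β (f.toFun (α σ))
        map_mul' := fun σ τ => by rw [map_mul, f.map_mul', map_mul, h] })
    (by
      rintro f f' ⟨b, hb⟩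
      refine ⟨β b, fun σ => ?_⟩
      change β (f.toFun (α σ)) = (β b)⁻¹ * β (f'.toFun (α σ)) * φ' σ (β b)
      rw [hb, map_mul, map_mul, map_inv, h])

end Cohomology

/-- The entrywise action on `GL_N F` of a monoid acting on the `k`-algebra `F`
by `k`-algebra endomorphisms. -/
noncomputable def glAction {k F M : Type*} [CommRing k] [CommRing F] [Algebra k F] [Monoid M]
    (N : ℕ) (ρ : M →* (F →ₐ[k] F)) : M →* Monoid.End (GL (Fin N) F) where
  toFun σ := Matrix.GeneralLinearGroup.map (ρ σ : F →+* F)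
  map_one' := by
    ext g i j
    rw [map_one]
    rfl
  map_mul' σ τ := by
    ext g i j
    rw [map_mul]
    rfl

lemma glAction_apply {k F M : Type*} [CommRing k] [CommRing F] [Algebra k F] [Monoid M]
    (N : ℕ) (ρ : M →* (F →ₐ[k] F)) (σ : M) (g : GL (Fin N) F) (i j : Fin N) :
    (glAction N ρ σ g : GL (Fin N) F) i j = ρ σ (g i j) := rfl

variable (k : Type*) [Field k] (n : ℕ)

/-! ### The monoid `Mat_{n×n}^{det ≠ 0} ℤ ⋉ T`, where `T = (kˣ)ⁿ` -/

/-- The underlying set of `Mat_{n×n}^{det ≠ 0} ℤ ⋉ (kˣ)ⁿ`.  The element `(λ, t)` is the product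
`λ · t`; it stands for the endomorphism `x_j ↦ t_j ∏ i, x_i ^ λ_ij` of `k(x₁,…,xₙ)`. -/
@[ext] structure IntTorusEnd where
  mat : Matrix (Fin n) (Fin n) ℤ
  det_ne_zero : mat.det ≠ 0
  trans : Fin n → kˣ

namespace IntTorusEnd

variable {k n}

/-- The product is determined by `t · λ = λ · t^λ`, where `(t^λ)_j = ∏ i, t_i ^ λ_ij`. -/
instance : Mul (IntTorusEnd k n) where
  mul a b :=
    { mat := a.mat * b.mat
      det_ne_zero := by
        rw [Matrix.det_mul]
        exact mul_ne_zero a.det_ne_zero b.det_ne_zero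
      trans := fun j => (∏ i, a.trans i ^ b.mat i j) * b.trans j }

instance : One (IntTorusEnd k n) where
  one :=
    { mat := 1
      det_ne_zero := by simp
      trans := 1 }

@[simp] lemma mul_mat (a b : IntTorusEnd k n) : (a * b).mat = a.mat * b.mat := rfl
@[simp] lemma mul_trans (a b : IntTorusEnd k n) (j : Fin n) :
    (a * b).trans j = (∏ i, a.trans i ^ b.mat i j) * b.trans j := rfl
@[simp] lemma one_mat : (1 : IntTorusEnd k n).mat = 1 := rfl
@[simp] lemma one_trans : (1 : IntTorusEnd k n).trans = 1 := rfl

lemma prod_zpow_sum {G ι : Type*} [CommGroup G] (s : Finset ι) (g : G) (e : ι → ℤ) :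
    ∏ i ∈ s, g ^ e i = g ^ ∑ i ∈ s, e i := by
  classical
  induction s using Finset.induction_on with
  | empty => simp
  | insert i s hi ih => rw [Finset.prod_insert hi, Finset.sum_insert hi, zpow_add, ih]

lemma prod_zpow_one {G : Type*} [CommGroup G] (t : Fin n → G) (j : Fin n) :
    ∏ i, t i ^ (1 : Matrix (Fin n) (Fin n) ℤ) i j = t j := by
  rw [Finset.prod_eq_single j]
  · simp
  · intro i _ hi
    simp [Matrix.one_apply_ne hi]
  · simp

lemma prod_zpow_mul {G : Type*} [CommGroup G] (t : Fin n → G)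
    (P Q : Matrix (Fin n) (Fin n) ℤ) (j : Fin n) :
    ∏ i, (∏ l, t l ^ P l i) ^ Q i j = ∏ l, t l ^ (P * Q) l j := by
  simp_rw [← Finset.prod_zpow, ← zpow_mul]
  rw [Finset.prod_comm]
  refine Finset.prod_congr rfl fun l _ => ?_
  rw [Matrix.mul_apply, prod_zpow_sum]

instance : Monoid (IntTorusEnd k n) where
  mul_assoc a b c := by
    ext1
    · simp [Matrix.mul_assoc]
    · funext j
      simp only [mul_trans, mul_mat, mul_zpow, Finset.prod_mul_distrib, prod_zpow_mul, mul_assoc]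
  one_mul a := by
    ext1
    · simp
    · funext j
      simp
  mul_one a := by
    ext1
    · simp
    · funext j
      simp [prod_zpow_one]

end IntTorusEnd

/-! ### The group `GL_n ℚ ⋉ (T ⊗ ℚ)` -/

/-- The underlying set of `GL_n ℚ ⋉ (T ⊗ ℚ)`.  The group `kˣ` is written additively, and
`T ⊗ ℚ = (kˣ)ⁿ ⊗ ℚ` is written as `(kˣ ⊗ ℚ)ⁿ`.  The element `(g, u)` is the product `g · u`. -/
@[ext] structure RatTorusAut where
  mat : GL (Fin n) ℚ
  trans : Fin n → ℚ ⊗[ℤ] Additive kˣ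

namespace RatTorusAut

variable {k n}

/-- The natural right action of rational matrices on `T ⊗ ℚ`, the `ℚ`-linear extension of
`(t^λ)_j = ∏ i, t_i ^ λ_ij`. -/
noncomputable def act (u : Fin n → ℚ ⊗[ℤ] Additive kˣ) (g : Matrix (Fin n) (Fin n) ℚ) :
    Fin n → ℚ ⊗[ℤ] Additive kˣ :=
  fun j => ∑ i, g i j • u i

lemma act_one (u : Fin n → ℚ ⊗[ℤ] Additive kˣ) : act u 1 = u := by
  funext j
  unfold act
  rw [Finset.sum_eq_single j]
  · simp
  · intro i _ hi
    simp [Matrix.one_apply_ne hi]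
  · simp

lemma act_mul (u : Fin n → ℚ ⊗[ℤ] Additive kˣ) (g h : Matrix (Fin n) (Fin n) ℚ) :
    act u (g * h) = act (act u g) h := by
  funext j
  simp only [act, Matrix.mul_apply, Finset.sum_smul, Finset.smul_sum, smul_smul]
  rw [Finset.sum_comm]
  simp only [mul_comm]

lemma act_add (u v : Fin n → ℚ ⊗[ℤ] Additive kˣ) (g : Matrix (Fin n) (Fin n) ℚ) :
    act (u + v) g = act u g + act v g := by
  funext j
  simp [act, Finset.sum_add_distrib]

lemma act_zero (g : Matrix (Fin n) (Fin n) ℚ) :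
    act (0 : Fin n → ℚ ⊗[ℤ] Additive kˣ) g = 0 := by
  funext j
  simp [act]

lemma act_neg (u : Fin n → ℚ ⊗[ℤ] Additive kˣ) (g : Matrix (Fin n) (Fin n) ℚ) :
    act (-u) g = -act u g := by
  rw [eq_neg_iff_add_eq_zero, ← act_add, neg_add_cancel, act_zero]

/-- The product is determined by `u · g = g · (u^g)`. -/
noncomputable instance : Mul (RatTorusAut k n) where
  mul a b := ⟨a.mat * b.mat, act a.trans b.mat + b.trans⟩

noncomputable instance : One (RatTorusAut k n) where
  one := ⟨1, 0⟩

noncomputable instance : Inv (RatTorusAut k n) where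
  inv a := ⟨a.mat⁻¹, -act a.trans (a.mat⁻¹ : GL (Fin n) ℚ)⟩

@[simp] lemma mul_mat (a b : RatTorusAut k n) : (a * b).mat = a.mat * b.mat := rfl
@[simp] lemma mul_trans (a b : RatTorusAut k n) :
    (a * b).trans = act a.trans b.mat + b.trans := rfl
@[simp] lemma one_mat : (1 : RatTorusAut k n).mat = 1 := rfl
@[simp] lemma one_trans : (1 : RatTorusAut k n).trans = 0 := rfl
@[simp] lemma inv_mat (a : RatTorusAut k n) : a⁻¹.mat = a.mat⁻¹ := rfl
@[simp] lemma inv_trans (a : RatTorusAut k n) :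
    a⁻¹.trans = -act a.trans (a.mat⁻¹ : GL (Fin n) ℚ) := rfl

noncomputable instance : Group (RatTorusAut k n) where
  mul_assoc a b c := by
    ext1
    · simp [mul_assoc]
    · simp only [mul_trans, mul_mat, Units.val_mul, act_mul, act_add, add_assoc]
  one_mul a := by
    ext1
    · simp
    · simp [act_zero]
  mul_one a := by
    ext1
    · simp
    · simp [act_one]
  inv_mul_cancel a := by
    ext1
    · simp
    · rw [mul_trans, inv_trans, act_neg, ← act_mul, ← Units.val_mul, inv_mul_cancel,
        Units.val_one, act_one, neg_add_cancel, one_trans]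

end RatTorusAut

/-- The natural homomorphism `Mat_{n×n}^{det ≠ 0} ℤ ⋉ T → GL_n ℚ ⋉ (T ⊗ ℚ)`,
`(λ, t) ↦ (λ, t ⊗ 1)`. -/
noncomputable def toRat : IntTorusEnd k n →* RatTorusAut k n where
  toFun a :=
    { mat := Matrix.GeneralLinearGroup.mkOfDetNeZero (a.mat.map (Int.cast : ℤ → ℚ)) (by
        have h := (Int.castRingHom ℚ).map_det a.mat
        rw [RingHom.mapMatrix_apply] at h
        change (a.mat.map (Int.castRingHom ℚ)).det ≠ 0
        rw [← h]
        simpa using a.det_ne_zero)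
      trans := fun j => (1 : ℚ) ⊗ₜ[ℤ] Additive.ofMul (a.trans j) }
  map_one' := by
    ext1
    · ext i j
      simp [Matrix.GeneralLinearGroup.mkOfDetNeZero, Matrix.one_apply]
    · funext j
      simp
  map_mul' a b := by
    ext1
    · ext i j
      simp [Matrix.GeneralLinearGroup.mkOfDetNeZero, Matrix.mul_apply]
    · funext j
      simp [Matrix.GeneralLinearGroup.mkOfDetNeZero, RatTorusAut.act, ofMul_prod, ofMul_zpow,
        TensorProduct.tmul_add, TensorProduct.tmul_sum]
      refine Finset.sum_congr rfl fun i _ => ?_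
      rw [Int.cast_smul_eq_zsmul]
      exact map_zsmul (TensorProduct.mk ℤ ℚ (Additive kˣ) 1) (b.mat i j)
        (Additive.ofMul (a.trans i))

/-! ### The action on `L = k(x₁,…,xₙ)` -/

/-- `L = k(x₁,…,xₙ)`. -/
abbrev RatFunField : Type _ := FractionRing (MvPolynomial (Fin n) k)

section Action

variable {k n}

/-- The coordinate functions, as units of `L`. -/
noncomputable def coord (i : Fin n) : (RatFunField k n)ˣ :=
  Units.mk0 (algebraMap (MvPolynomial (Fin n) k) (RatFunField k n) (MvPolynomial.X i)) (by
    simp [MvPolynomial.X_ne_zero])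

/-- The Laurent monomial `∏ i, x_i ^ v_i` of `L`. -/
noncomputable def laurent (v : Fin n → ℤ) : (RatFunField k n)ˣ := ∏ i, coord i ^ v i

lemma laurent_add (v w : Fin n → ℤ) :
    (laurent (v + w) : (RatFunField k n)ˣ) = laurent v * laurent w := by
  simp [laurent, zpow_add, Finset.prod_mul_distrib]

lemma laurent_natCast (m : Fin n →₀ ℕ) :
    ((laurent (fun i => (m i : ℤ)) : (RatFunField k n)ˣ) : RatFunField k n) =
      algebraMap (MvPolynomial (Fin n) k) (RatFunField k n) (MvPolynomial.monomial m 1) := by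
  rw [MvPolynomial.monomial_eq, Finsupp.prod_fintype _ _ (by simp)]
  simp [laurent, coord]

lemma linearIndependent_laurent :
    LinearIndependent k
      (fun v : Fin n → ℤ => ((laurent v : (RatFunField k n)ˣ) : RatFunField k n)) := by
  rw [linearIndependent_iff']
  intro s g hg v₀ hv₀
  let w : Fin n → ℤ := fun i => ∑ v ∈ s, |v i|
  let e : (Fin n → ℤ) → (Fin n →₀ ℕ) := fun v =>
    Finsupp.equivFunOnFinite.symm (fun i => (v i + w i).toNat)
  have hw : ∀ v ∈ s, ∀ i, 0 ≤ v i + w i := by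
    intro v hv i
    have h1 : |v i| ≤ w i :=
      Finset.single_le_sum (f := fun v : Fin n → ℤ => |v i|) (fun _ _ => abs_nonneg _) hv
    have h2 := neg_abs_le (v i)
    linarith
  have he : ∀ v ∈ s, (fun i => ((e v i : ℕ) : ℤ)) = v + w := by
    intro v hv
    funext i
    simp [e, Int.toNat_of_nonneg (hw v hv i)]
  have key : algebraMap (MvPolynomial (Fin n) k) (RatFunField k n)
      (∑ v ∈ s, MvPolynomial.monomial (e v) (g v)) = 0 := by
    have h : (∑ v ∈ s, g v • ((laurent v : (RatFunField k n)ˣ) : RatFunField k n)) *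
        ((laurent w : (RatFunField k n)ˣ) : RatFunField k n) = 0 := by rw [hg, zero_mul]
    rw [Finset.sum_mul] at h
    rw [map_sum, ← h]
    refine Finset.sum_congr rfl fun v hv => ?_
    rw [smul_mul_assoc, ← Units.val_mul, ← laurent_add, ← he v hv, laurent_natCast,
      ← algebraMap_smul (RatFunField k n) (g v), smul_eq_mul,
      IsScalarTower.algebraMap_apply k (MvPolynomial (Fin n) k) (RatFunField k n), ← map_mul,
      MvPolynomial.algebraMap_eq, MvPolynomial.C_mul_monomial, mul_one]
  have key' : ∑ v ∈ s, MvPolynomial.monomial (e v) (g v) = 0 :=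
    (map_eq_zero_iff _ (IsFractionRing.injective (MvPolynomial (Fin n) k) (RatFunField k n))).1 key
  have hc := congrArg (MvPolynomial.coeff (e v₀)) key'
  rw [MvPolynomial.coeff_sum, Finset.sum_eq_single v₀] at hc
  · simpa using hc
  · intro v hv hne
    rw [MvPolynomial.coeff_monomial, if_neg]
    intro h
    apply hne
    have h' : v + w = v₀ + w := by rw [← he v hv, ← he v₀ hv₀, h]
    exact add_right_cancel h'
  · intro h
    exact absurd hv₀ h

/-- The images `t_j ∏ i, x_i ^ λ_ij` of the coordinate functions `x_j`. -/
noncomputable def coordImage (a : IntTorusEnd k n) (j : Fin n) : (RatFunField k n)ˣ :=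
  Units.map (algebraMap k (RatFunField k n)).toMonoidHom (a.trans j) * ∏ i, coord i ^ a.mat i j

lemma aeval_coordImage_injective (a : IntTorusEnd k n) :
    Function.Injective (MvPolynomial.aeval (R := k)
      (fun j => ((coordImage a j : (RatFunField k n)ˣ) : RatFunField k n))) := by
  rw [injective_iff_map_eq_zero]
  intro p hp
  have hinj : Function.Injective
      (fun m : Fin n →₀ ℕ => a.mat.mulVec (fun i => (m i : ℤ))) := by
    intro m m' h
    have h0 : a.mat.mulVec ((fun i => (m i : ℤ)) - fun i => (m' i : ℤ)) = 0 := by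
      rw [Matrix.mulVec_sub]
      exact sub_eq_zero.2 h
    have h1 := Matrix.eq_zero_of_mulVec_eq_zero a.det_ne_zero h0
    ext i
    have h2 := congrFun h1 i
    simp only [Pi.sub_apply, Pi.zero_apply] at h2
    omega
  have hli := linearIndependent_iff'.1
    ((linearIndependent_laurent (k := k) (n := n)).comp _ hinj) p.support
    (fun m => p.coeff m * ((∏ j, a.trans j ^ m j : kˣ) : k)) (by
      rw [← hp, MvPolynomial.aeval_def, MvPolynomial.eval₂_eq']
      refine Finset.sum_congr rfl fun m _ => ?_
      have hm : ∏ j, coordImage a j ^ m j =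
          Units.map (algebraMap k (RatFunField k n)).toMonoidHom (∏ j, a.trans j ^ m j) *
            laurent (a.mat.mulVec (fun i => (m i : ℤ))) := by
        simp only [coordImage, mul_pow, Finset.prod_mul_distrib, map_prod, map_pow, laurent]
        congr 1
        simp_rw [← Finset.prod_pow, ← zpow_natCast, ← zpow_mul]
        rw [Finset.prod_comm]
        refine Finset.prod_congr rfl fun i _ => ?_
        rw [IntTorusEnd.prod_zpow_sum]
        rfl
      have hm' := congrArg (Units.val) hm
      rw [Units.coe_prod] at hm'
      simp only [Units.val_pow_eq_pow_val] at hm'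
      rw [hm', Algebra.smul_def, map_mul, Units.val_mul, mul_assoc]
      rfl)
  ext m
  by_cases hm : m ∈ p.support
  · have := hli m hm
    simpa using (mul_eq_zero.1 this).resolve_right (Units.ne_zero _)
  · simpa using hm

/-- The `k`-endomorphism `x_j ↦ t_j ∏ i, x_i ^ λ_ij` of `L`. -/
noncomputable def endo (a : IntTorusEnd k n) : RatFunField k n →ₐ[k] RatFunField k n :=
  IsFractionRing.liftAlgHom (aeval_coordImage_injective a)

lemma endo_coord (a : IntTorusEnd k n) (j : Fin n) :
    endo a (coord j : (RatFunField k n)ˣ) = (coordImage a j : (RatFunField k n)ˣ) := by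
  simp [endo, coord, IsFractionRing.liftAlgHom_apply]

lemma endo_ext {f g : RatFunField k n →ₐ[k] RatFunField k n}
    (h : ∀ j, f (coord j : (RatFunField k n)ˣ) = g (coord j : (RatFunField k n)ˣ)) : f = g := by
  apply IsLocalization.algHom_ext (nonZeroDivisors (MvPolynomial (Fin n) k))
  apply MvPolynomial.algHom_ext
  intro j
  exact h j

lemma endo_coordImage (a b : IntTorusEnd k n) (j : Fin n) :
    endo a (coordImage b j : (RatFunField k n)ˣ) =
      (coordImage (a * b) j : (RatFunField k n)ˣ) := by
  have h : ∀ i, Units.map (endo a : RatFunField k n →* RatFunField k n) (coord i) =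
      coordImage a i := fun i => Units.ext (endo_coord a i)
  have h' : ∀ c : kˣ, Units.map (endo a : RatFunField k n →* RatFunField k n)
      (Units.map (algebraMap k (RatFunField k n)).toMonoidHom c) =
      Units.map (algebraMap k (RatFunField k n)).toMonoidHom c :=
    fun c => Units.ext ((endo a).commutes c)
  suffices H : Units.map (endo a : RatFunField k n →* RatFunField k n) (coordImage b j) =
      coordImage (a * b) j from congrArg Units.val H
  rw [coordImage, map_mul, h', map_prod]
  simp only [map_zpow, h]
  simp only [coordImage, mul_zpow, Finset.prod_mul_distrib, IntTorusEnd.mul_trans,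
    IntTorusEnd.mul_mat, IntTorusEnd.prod_zpow_mul, map_mul, map_prod, map_zpow]
  have hcomm : ∀ p q r : (RatFunField k n)ˣ, p * (q * r) = q * p * r :=
    fun p q r => by rw [← mul_assoc, mul_comm p q]
  exact hcomm _ _ _

end Action

/-- The action of `Mat_{n×n}^{det ≠ 0} ℤ ⋉ T` on `L` by `k`-algebra endomorphisms. -/
noncomputable def endoHom : IntTorusEnd k n →* (RatFunField k n →ₐ[k] RatFunField k n) where
  toFun a := endo a
  map_one' := by
    apply endo_ext
    intro j
    rw [endo_coord, coordImage]
    simp [IntTorusEnd.prod_zpow_one]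
  map_mul' a b := by
    apply endo_ext
    intro j
    rw [AlgHom.mul_apply, endo_coord, endo_coord, endo_coordImage]

/-! ### The comparison map -/

/-- `H¹(GL_n ℚ ⋉ (T ⊗ ℚ), GL_N k)`; the group acts trivially on the constants `k`. -/
abbrev H1Rat (N : ℕ) : Type _ :=
  H1 (1 : RatTorusAut k n →* Monoid.End (GL (Fin N) k))

/-- `H¹(Mat_{n×n}^{det ≠ 0} ℤ ⋉ T, GL_N L)`. -/
abbrev H1Int (N : ℕ) : Type _ := H1 (glAction N (endoHom k n))

/-- The map induced by restriction along `Mat_{n×n}^{det ≠ 0} ℤ ⋉ T → GL_n ℚ ⋉ (T ⊗ ℚ)` and by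
the inclusion `GL_N k ⊂ GL_N L`. -/
noncomputable def comparison (N : ℕ) : H1Rat k n N → H1Int k n N :=
  H1.map (toRat k n) (Matrix.GeneralLinearGroup.map (algebraMap k (RatFunField k n))) (by
    intro σ g
    ext i j
    rw [glAction_apply]
    exact ((endoHom k n σ).commutes (g i j)).symm)

end TorusCohomology

/-!
# Semilinear representations of `Mat_{n×n}^{det ≠ 0} ℤ ⋉ T` on finite-dimensional `L`-spaces

Let `H` be the group of `l`-primary torsion points of `T = (kˣ)ⁿ`. It is Zariski dense in `T`, so
the functions in `L` invariant under `H` are the constants, and its eigenfunctions are the multiples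
of Laurent monomials (`exists_eq_smul_laurent`). Everything is governed by the restriction to `H`.

*Injectivity.* The elements of `H` become trivial in `GL_n ℚ ⋉ (T ⊗ ℚ)`. Hence a matrix `b` relating
two cocycles that come from this group is `H`-invariant, so it is constant, and it relates them on
the whole group because every element of the group is a fraction with a scalar matrix as denominator
(`exists_mul_toRat_ofNat_eq`).

*Surjectivity.* The main point is that every cocycle `f` is cohomologous to one that is trivial on
`H` (`exists_twist_torsion_eq_one`).

* The degrees of `f_t`, `t ∈ H`, are bounded (`exists_boundedDegree_torsion`). Let `A` be the value
  of `f` at the scalar `s = l + 1`. The relation `f_{t ^ s}(x ^ s) = A(x)⁻¹ f_t(x) A(t x)` gives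
  `s · deg f_{t ^ s} ≤ deg f_t + const`, and `t ↦ t ^ s` permutes the points of a given order.
* There are polynomials `g, g' ≠ 0` such that `g(x) g'(ζ x) f_ζ(x)` is polynomial for all `ζ ∈ H`
  (`exists_common_denominators`). By `f_ζ(x) = f_{ζη}(x) f_η(ζ x)⁻¹` the denominator
  of `f_ζ` divides the product of those of `f_{ζη}`, at `x`, and of `f_η⁻¹`, at `ζ x`, for every
  `η ∈ H`. Averaging multiplicities over the `η` of a given level, and passing to the limit along an
  ultrafilter on the levels, leaves two fixed divisors.
* So the `H`-translates of the vectors `g' e_j` span a finite-dimensional space over `k`. Its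
  `H`-eigenvectors contain a basis of `L ^ N`, in which `f` is diagonal on `H`, given by characters
  `χ_1, …, χ_N` (`exists_eigenbasis`).
* For each `s ≥ 1`, the value of `f` at the scalar `s` shows that each `χ_i` agrees with some
  `χ_j ^ s` up to an algebraic character `ζ ↦ ζ ^ e`. A finite set in a commutative group contained
  in all its images under power maps is trivial (`eq_one_of_forall_exists_eq_pow`), so the `χ_i` are
  algebraic (`exists_exponent`), and Laurent monomials remove them.

If `f` is trivial on `H`, then `ζ σ = σ ζ ^ λ` for `σ = (λ, t)` shows that every `f_σ` is
`H`-invariant, hence constant. So `f` is a homomorphism to `GL_N k`; it extends to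
`GL_n ℚ ⋉ (T ⊗ ℚ)`, which is a group of fractions of the monoid (`exists_extension`).
-/

namespace TorusCohomology

/-! ### Rescaling and contracting the variables of a polynomial -/

section Polynomials

open MvPolynomial

variable {k : Type*} [Field k] {n : ℕ}

/-- The substitution `x_i ↦ t_i x_i` in `k[x₁,…,xₙ]`. -/
noncomputable def rescale (t : Fin n → kˣ) : MvPolynomial (Fin n) k →ₐ[k] MvPolynomial (Fin n) k :=
  aeval fun i => C (t i : k) * X i

lemma rescale_monomial (t : Fin n → kˣ) (m : Fin n →₀ ℕ) (c : k) :
    rescale t (monomial m c) = monomial m ((∏ i, (t i : k) ^ m i) * c) := by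
  rw [rescale, aeval_monomial, Finsupp.prod_fintype _ _ (by simp), monomial_eq (s := m),
    Finsupp.prod_fintype _ _ (by simp)]
  simp only [mul_pow, Finset.prod_mul_distrib, algebraMap_eq, map_mul, map_prod, map_pow]
  ring

lemma coeff_rescale (t : Fin n → kˣ) (m : Fin n →₀ ℕ) (p : MvPolynomial (Fin n) k) :
    coeff m (rescale t p) = (∏ i, (t i : k) ^ m i) * coeff m p := by
  classical
  induction p using MvPolynomial.induction_on' with
  | monomial u a =>
    rw [rescale_monomial, coeff_monomial, coeff_monomial]
    split_ifs with h
    · rw [h]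
    · simp
  | add p q hp hq => rw [map_add, coeff_add, hp, hq, coeff_add, mul_add]

lemma rescale_mul_apply (t u : Fin n → kˣ) (p : MvPolynomial (Fin n) k) :
    rescale (t * u) p = rescale t (rescale u p) := by
  ext m
  simp only [coeff_rescale, Pi.mul_apply, Units.val_mul, mul_pow, Finset.prod_mul_distrib]
  ring

lemma rescale_one_apply (p : MvPolynomial (Fin n) k) : rescale (1 : Fin n → kˣ) p = p := by
  ext m
  simp [coeff_rescale]

lemma rescale_inv_rescale (t : Fin n → kˣ) (p : MvPolynomial (Fin n) k) :
    rescale t⁻¹ (rescale t p) = p := by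
  rw [← rescale_mul_apply, inv_mul_cancel, rescale_one_apply]

lemma rescale_rescale_inv (t : Fin n → kˣ) (p : MvPolynomial (Fin n) k) :
    rescale t (rescale t⁻¹ p) = p := by
  rw [← rescale_mul_apply, mul_inv_cancel, rescale_one_apply]

lemma rescale_ne_zero (t : Fin n → kˣ) {p : MvPolynomial (Fin n) k} (hp : p ≠ 0) :
    rescale t p ≠ 0 := by
  intro h
  apply hp
  rw [← rescale_inv_rescale t p, h, map_zero]

lemma support_rescale (t : Fin n → kˣ) (p : MvPolynomial (Fin n) k) :
    (rescale t p).support = p.support := by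
  ext m
  have h : ∏ i, (t i : k) ^ m i ≠ 0 :=
    Finset.prod_ne_zero_iff.2 fun i _ => pow_ne_zero _ (t i).ne_zero
  simp [mem_support_iff, coeff_rescale, h]

lemma totalDegree_rescale (t : Fin n → kˣ) (p : MvPolynomial (Fin n) k) :
    (rescale t p).totalDegree = p.totalDegree := by
  rw [totalDegree, support_rescale, totalDegree]

lemma totalDegree_pow_of_isDomain {p : MvPolynomial (Fin n) k} (hp : p ≠ 0) (m : ℕ) :
    (p ^ m).totalDegree = m * p.totalDegree := by
  induction m with
  | zero => simp
  | succ m ih =>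
    rw [pow_succ, totalDegree_mul_of_isDomain (pow_ne_zero _ hp) hp, ih]
    ring

/-- The exponent `s m + a`. -/
noncomputable def dilate (s : ℕ) (a m : Fin n →₀ ℕ) : Fin n →₀ ℕ := s • m + a

lemma dilate_injective {s : ℕ} (hs : 0 < s) (a : Fin n →₀ ℕ) :
    Function.Injective (dilate s a) := by
  intro m m' h
  ext i
  have := DFunLike.congr_fun h i
  simp only [dilate, Finsupp.add_apply, Finsupp.smul_apply, smul_eq_mul, add_left_inj] at this
  exact Nat.eq_of_mul_eq_mul_left hs this

/-- The part of `p` supported on exponents `s m + a`, divided by `x ^ a` and with `x ^ s` replaced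
by `x`. -/
noncomputable def contract {s : ℕ} (hs : 0 < s) (a : Fin n →₀ ℕ) (p : MvPolynomial (Fin n) k) :
    MvPolynomial (Fin n) k :=
  ∑ m ∈ p.support.preimage (dilate s a) (dilate_injective hs a).injOn,
    monomial m (coeff (dilate s a m) p)

lemma coeff_contract {s : ℕ} (hs : 0 < s) (a m : Fin n →₀ ℕ) (p : MvPolynomial (Fin n) k) :
    coeff m (contract hs a p) = coeff (dilate s a m) p := by
  classical
  simp only [contract, coeff_sum, coeff_monomial]
  rw [Finset.sum_ite_eq']
  split_ifs with h
  · rfl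
  · rw [Finset.mem_preimage, notMem_support_iff] at h
    exact h.symm

lemma contract_mul_expand {s : ℕ} (hs : 0 < s) {a : Fin n →₀ ℕ} (ha : ∀ i, a i < s)
    (p q : MvPolynomial (Fin n) k) :
    contract hs a (p * expand s q) = contract hs a p * q := by
  induction q using MvPolynomial.induction_on' with
  | monomial u c =>
    ext m
    have hiff : s • u ≤ dilate s a m ↔ u ≤ m := by
      simp only [Finsupp.le_def, dilate, Finsupp.add_apply, Finsupp.smul_apply, smul_eq_mul]
      refine forall_congr' fun i => ⟨fun h => ?_, fun h => ?_⟩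
      · by_contra! hlt
        have h1 := Nat.mul_le_mul_left s (Nat.succ_le_of_lt hlt)
        have h2 := ha i
        rw [Nat.mul_succ] at h1
        omega
      · exact (Nat.mul_le_mul_left s h).trans (Nat.le_add_right _ _)
    rw [expand_monomial, coeff_contract, coeff_mul_monomial', coeff_mul_monomial',
      coeff_contract]
    simp only [hiff]
    split_ifs with h
    · congr 2
      ext i
      have := h i
      simp only [dilate, Finsupp.add_apply, Finsupp.smul_apply, Finsupp.tsub_apply, smul_eq_mul,
        Nat.mul_sub]
      have := Nat.mul_le_mul_left s this
      omega
    · rfl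
  | add q r hq hr =>
    rw [map_add, mul_add, mul_add, ← hq, ← hr]
    ext m
    simp only [coeff_contract, coeff_add]

lemma mul_totalDegree_contract_le {s : ℕ} (hs : 0 < s) (a : Fin n →₀ ℕ)
    (p : MvPolynomial (Fin n) k) : s * (contract hs a p).totalDegree ≤ p.totalDegree := by
  have : (contract hs a p).totalDegree ≤ p.totalDegree / s := by
    refine Finset.sup_le fun m hm => ?_
    rw [mem_support_iff, coeff_contract, ← mem_support_iff] at hm
    rw [Nat.le_div_iff_mul_le hs]
    refine le_trans ?_ (le_totalDegree hm)
    rw [Finsupp.sum_fintype _ _ (by simp), Finsupp.sum_fintype _ _ (by simp), Finset.sum_mul]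
    refine Finset.sum_le_sum fun i _ => ?_
    simp only [dilate, Finsupp.add_apply, Finsupp.smul_apply, smul_eq_mul]
    rw [mul_comm]
    exact Nat.le_add_right _ _
  calc s * (contract hs a p).totalDegree ≤ s * (p.totalDegree / s) := Nat.mul_le_mul_left s this
    _ ≤ p.totalDegree := Nat.mul_div_le _ _

lemma exists_contract_ne_zero {s : ℕ} (hs : 0 < s) {p : MvPolynomial (Fin n) k} (hp : p ≠ 0) :
    ∃ a : Fin n →₀ ℕ, (∀ i, a i < s) ∧ contract hs a p ≠ 0 := by
  obtain ⟨m, hm⟩ := ne_zero_iff.1 hp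
  refine ⟨m.mapRange (· % s) (Nat.zero_mod s), fun i => ?_, fun h => hm ?_⟩
  · simpa using Nat.mod_lt _ hs
  · have := congrArg (coeff (m.mapRange (· / s) (Nat.zero_div s))) h
    rw [coeff_contract, coeff_zero] at this
    convert this using 2
    ext i
    simp [dilate, Nat.div_add_mod]

end Polynomials

/-! ### Translations and scalar matrices -/

section Elements

variable {k : Type*} [Field k] {n : ℕ}

namespace IntTorusEnd

/-- The element `(1, t)`, acting by `x_j ↦ t_j x_j`. -/
def ofTrans (t : Fin n → kˣ) : IntTorusEnd k n := ⟨1, by simp, t⟩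

/-- The element `(s · 1, 1)`, acting by `x_j ↦ x_j ^ s`. -/
def ofNat (k : Type*) [Field k] (n : ℕ) (s : ℕ) (hs : 0 < s) : IntTorusEnd k n :=
  ⟨Matrix.scalar (Fin n) (s : ℤ), by
    rw [Matrix.scalar_apply, Matrix.det_diagonal]
    exact Finset.prod_ne_zero_iff.2 fun _ _ => by exact_mod_cast hs.ne', 1⟩

@[simp] lemma ofTrans_mat (t : Fin n → kˣ) : (ofTrans t).mat = 1 := rfl
@[simp] lemma ofTrans_trans (t : Fin n → kˣ) : (ofTrans t).trans = t := rfl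
@[simp] lemma ofNat_mat {s : ℕ} (hs : 0 < s) :
    (ofNat k n s hs).mat = Matrix.scalar (Fin n) (s : ℤ) := rfl
@[simp] lemma ofNat_trans {s : ℕ} (hs : 0 < s) : (ofNat k n s hs).trans = 1 := rfl

lemma prod_zpow_scalar {G : Type*} [CommGroup G] (t : Fin n → G) (s : ℕ) (j : Fin n) :
    ∏ i, t i ^ (Matrix.scalar (Fin n) (s : ℤ)) i j = t j ^ s := by
  rw [Matrix.scalar_apply, Finset.prod_eq_single j]
  · rw [Matrix.diagonal_apply_eq, zpow_natCast]
  · intro i _ hi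
    rw [Matrix.diagonal_apply_ne _ hi, zpow_zero]
  · simp

lemma ofTrans_mul (t u : Fin n → kˣ) : ofTrans (t * u) = ofTrans t * ofTrans u := by
  ext1
  · simp
  · funext j
    simp [prod_zpow_one]

lemma ofTrans_one : ofTrans (1 : Fin n → kˣ) = 1 := rfl

/-- Translations move past an element `(λ, u)` by `t ↦ t ^ λ`. -/
lemma ofTrans_mul_eq (t : Fin n → kˣ) (a : IntTorusEnd k n) :
    ofTrans t * a = a * ofTrans (fun j => ∏ i, t i ^ a.mat i j) := by
  ext1
  · simp
  · funext j
    simp [prod_zpow_one, mul_comm]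

lemma ofTrans_mul_ofNat (t : Fin n → kˣ) {s : ℕ} (hs : 0 < s) :
    ofTrans t * ofNat k n s hs = ofNat k n s hs * ofTrans (t ^ s) := by
  rw [ofTrans_mul_eq]
  congr 2
  funext j
  exact prod_zpow_scalar t s j

end IntTorusEnd

open IntTorusEnd

lemma endo_ofTrans_algebraMap (t : Fin n → kˣ) (p : MvPolynomial (Fin n) k) :
    endo (ofTrans t) (algebraMap _ (RatFunField k n) p) = algebraMap _ _ (rescale t p) := by
  suffices h : (endo (ofTrans t)).comp (IsScalarTower.toAlgHom k _ (RatFunField k n)) =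
      (IsScalarTower.toAlgHom k (MvPolynomial (Fin n) k) (RatFunField k n)).comp (rescale t) from
    DFunLike.congr_fun h p
  apply MvPolynomial.algHom_ext
  intro j
  refine (endo_coord _ j).trans ?_
  rw [coordImage, ofTrans_mat, prod_zpow_one]
  simp [rescale, coord, IsScalarTower.algebraMap_apply k (MvPolynomial (Fin n) k) (RatFunField k n),
    MvPolynomial.algebraMap_eq]

lemma endo_ofNat_algebraMap {s : ℕ} (hs : 0 < s) (p : MvPolynomial (Fin n) k) :
    endo (ofNat k n s hs) (algebraMap _ (RatFunField k n) p) =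
      algebraMap _ _ (MvPolynomial.expand s p) := by
  suffices h : (endo (ofNat k n s hs)).comp (IsScalarTower.toAlgHom k _ (RatFunField k n)) =
      (IsScalarTower.toAlgHom k (MvPolynomial (Fin n) k) (RatFunField k n)).comp
        (MvPolynomial.expand s) from
    DFunLike.congr_fun h p
  apply MvPolynomial.algHom_ext
  intro j
  refine (endo_coord _ j).trans ?_
  rw [coordImage, ofNat_mat, prod_zpow_scalar]
  simp [coord]

end Elements

/-! ### Matrices of rational functions of bounded degree -/

section BoundedDegree

open MvPolynomial IntTorusEnd

variable {k : Type*} [Field k] {n N : ℕ}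

/-- The entries of `g` have a common denominator of total degree at most `d`, with numerators
of total degree at most `d`. -/
def BoundedDegree (d : ℕ) (g : Matrix (Fin N) (Fin N) (RatFunField k n)) : Prop :=
  ∃ Q : MvPolynomial (Fin n) k, Q ≠ 0 ∧ Q.totalDegree ≤ d ∧ ∀ i j, ∃ P : MvPolynomial (Fin n) k,
    P.totalDegree ≤ d ∧ algebraMap _ (RatFunField k n) Q * g i j = algebraMap _ _ P

lemma BoundedDegree.mono {d d' : ℕ} (h : d ≤ d') {g : Matrix (Fin N) (Fin N) (RatFunField k n)}
    (hg : BoundedDegree d g) : BoundedDegree d' g := by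
  obtain ⟨Q, hQ, hd, hP⟩ := hg
  refine ⟨Q, hQ, hd.trans h, fun i j => ?_⟩
  obtain ⟨P, hP, hPQ⟩ := hP i j
  exact ⟨P, hP.trans h, hPQ⟩

lemma exists_boundedDegree (g : Matrix (Fin N) (Fin N) (RatFunField k n)) :
    ∃ d, BoundedDegree d g := by
  obtain ⟨Q, hQ⟩ := IsLocalization.exist_integer_multiples_of_finite
    (nonZeroDivisors (MvPolynomial (Fin n) k)) (fun x : Fin N × Fin N => g x.1 x.2)
  choose P hP using hQ
  refine ⟨max (Q : MvPolynomial (Fin n) k).totalDegree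
    (Finset.univ.sup fun x => (P x).totalDegree), Q, nonZeroDivisors.coe_ne_zero Q,
    le_max_left _ _, fun i j => ⟨P (i, j), ?_, ?_⟩⟩
  · exact le_max_of_le_right (Finset.le_sup (f := fun x => (P x).totalDegree) (Finset.mem_univ _))
  · rw [hP, Algebra.smul_def]

lemma BoundedDegree.mul {d d' : ℕ} {g g' : Matrix (Fin N) (Fin N) (RatFunField k n)}
    (hg : BoundedDegree d g) (hg' : BoundedDegree d' g') : BoundedDegree (d + d') (g * g') := by
  obtain ⟨Q, hQ, hd, hP⟩ := hg
  obtain ⟨Q', hQ', hd', hP'⟩ := hg'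
  choose P hP hPQ using hP
  choose P' hP' hPQ' using hP'
  refine ⟨Q * Q', mul_ne_zero hQ hQ', (totalDegree_mul _ _).trans (add_le_add hd hd'),
    fun i j => ⟨∑ l, P i l * P' l j, ?_, ?_⟩⟩
  · exact totalDegree_finsetSum_le fun l _ =>
      (totalDegree_mul _ _).trans (add_le_add (hP i l) (hP' l j))
  · rw [Matrix.mul_apply, Finset.mul_sum, map_sum]
    refine Finset.sum_congr rfl fun l _ => ?_
    rw [map_mul, map_mul, ← hPQ, ← hPQ']
    ring

lemma BoundedDegree.map_ofTrans {d : ℕ} {g : Matrix (Fin N) (Fin N) (RatFunField k n)}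
    (hg : BoundedDegree d g) (t : Fin n → kˣ) : BoundedDegree d (g.map (endo (ofTrans t))) := by
  obtain ⟨Q, hQ, hd, hP⟩ := hg
  refine ⟨rescale t Q, rescale_ne_zero t hQ, (totalDegree_rescale t Q).trans_le hd,
    fun i j => ?_⟩
  obtain ⟨P, hP, hPQ⟩ := hP i j
  refine ⟨rescale t P, (totalDegree_rescale t P).trans_le hP, ?_⟩
  rw [← endo_ofTrans_algebraMap, ← endo_ofTrans_algebraMap, ← hPQ, map_mul, Matrix.map_apply]

/-- The substitution `x_j ↦ x_j ^ s` multiplies degrees by `s`: a denominator of `g(x ^ s)` can be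
replaced by its part on one residue class of exponents modulo `s`. -/
lemma BoundedDegree.of_map_ofNat {d s : ℕ} (hs : 0 < s)
    {g : Matrix (Fin N) (Fin N) (RatFunField k n)}
    (hg : BoundedDegree d (g.map (endo (ofNat k n s hs)))) : BoundedDegree (d / s) g := by
  obtain ⟨Q, hQ, hd, hP⟩ := hg
  obtain ⟨a, ha, hQa⟩ := exists_contract_ne_zero hs hQ
  have hdeg : ∀ p : MvPolynomial (Fin n) k, p.totalDegree ≤ d →
      (contract hs a p).totalDegree ≤ d / s := fun p hp => by
    rw [Nat.le_div_iff_mul_le hs, mul_comm]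
    exact (mul_totalDegree_contract_le hs a p).trans hp
  refine ⟨contract hs a Q, hQa, hdeg Q hd, fun i j => ?_⟩
  obtain ⟨P, hP, hPQ⟩ := hP i j
  refine ⟨contract hs a P, hdeg P hP, ?_⟩
  obtain ⟨u, v, hv, huv⟩ := IsFractionRing.div_surjective (A := MvPolynomial (Fin n) k) (g i j)
  have hv0 : algebraMap _ (RatFunField k n) v ≠ 0 :=
    IsFractionRing.to_map_ne_zero_of_mem_nonZeroDivisors hv
  have hv1 : algebraMap _ (RatFunField k n) (expand s v) ≠ 0 := by
    rw [Ne, map_eq_zero_iff _ (IsFractionRing.injective (MvPolynomial (Fin n) k) _)]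
    exact (expand_ne_zero hs).2 (nonZeroDivisors.ne_zero hv)
  have h1 : Q * expand s u = P * expand s v := by
    apply IsFractionRing.injective (MvPolynomial (Fin n) k) (RatFunField k n)
    rw [map_mul, map_mul, ← hPQ, Matrix.map_apply, ← huv, map_div₀, endo_ofNat_algebraMap,
      endo_ofNat_algebraMap]
    field_simp
  have h2 := congrArg (contract hs a) h1
  rw [contract_mul_expand hs ha, contract_mul_expand hs ha] at h2
  have h3 := congrArg (algebraMap _ (RatFunField k n)) h2
  rw [map_mul, map_mul] at h3
  rw [← huv]
  field_simp
  rw [h3, mul_comm]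

end BoundedDegree

/-! ### Cocycles on the torsion translations -/

section Torsion

open IntTorusEnd

variable (k : Type*) [Field k] (n l : ℕ)

/-- The points of order dividing `l ^ m` in `(kˣ)ⁿ`. -/
def torsionLevel (m : ℕ) : Subgroup (Fin n → kˣ) := (powMonoidHom (l ^ m)).ker

/-- The `l`-primary torsion points of `(kˣ)ⁿ`. -/
def primaryTorsion : Subgroup (Fin n → kˣ) where
  carrier := {t | ∃ m : ℕ, t ^ l ^ m = 1}
  one_mem' := ⟨0, one_pow _⟩
  mul_mem' := by
    rintro t u ⟨a, ha⟩ ⟨b, hb⟩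
    exact ⟨a + b, by rw [mul_pow, pow_add, pow_mul, ha, one_pow, one_mul, mul_comm, pow_mul, hb,
      one_pow]⟩
  inv_mem' := by
    rintro t ⟨a, ha⟩
    exact ⟨a, by rw [inv_pow, ha, inv_one]⟩

variable {k n l}

lemma mem_torsionLevel {m : ℕ} {t : Fin n → kˣ} : t ∈ torsionLevel k n l m ↔ t ^ l ^ m = 1 :=
  Iff.rfl

lemma mem_primaryTorsion {t : Fin n → kˣ} :
    t ∈ primaryTorsion k n l ↔ ∃ m, t ∈ torsionLevel k n l m := Iff.rfl

lemma torsionLevel_mono {m m' : ℕ} (h : m ≤ m') : torsionLevel k n l m ≤ torsionLevel k n l m' := by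
  intro t ht
  obtain ⟨c, rfl⟩ := Nat.exists_eq_add_of_le h
  rw [mem_torsionLevel] at *
  rw [pow_add, pow_mul, ht, one_pow]

lemma finite_torsionLevel (hl : 2 ≤ l) (m : ℕ) : Finite (torsionLevel k n l m) := by
  have : NeZero (l ^ m) := ⟨pow_ne_zero _ (by omega)⟩
  let F : torsionLevel k n l m → Fin n → rootsOfUnity (l ^ m) k := fun t i =>
    ⟨t.1 i, congrFun t.2 i⟩
  refine Finite.of_injective F fun t u h => Subtype.ext (funext fun i => ?_)
  exact congrArg Subtype.val (congrFun h i)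

/-- Since `l + 1` is prime to the orders of the points of a given level, its power map is
surjective on them. -/
lemma exists_pow_eq_of_mem_torsionLevel {m : ℕ} {t : Fin n → kˣ} (ht : t ∈ torsionLevel k n l m) :
    ∃ u ∈ torsionLevel k n l m, u ^ (l + 1) = t := by
  have hcop : Nat.Coprime (l + 1) (l ^ m) := Nat.Coprime.pow_right _ (by simp)
  obtain ⟨e, he⟩ := exists_pow_eq_self_of_coprime
    (n := l + 1) (x := t) (hcop.coprime_dvd_right (orderOf_dvd_of_pow_eq_one ht))
  refine ⟨t ^ e, Subgroup.pow_mem _ ht e, ?_⟩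
  rw [← pow_mul, mul_comm, pow_mul, he]

variable {N : ℕ}

lemma coe_glAction (σ : IntTorusEnd k n) (g : GL (Fin N) (RatFunField k n)) :
    ((glAction N (endoHom k n) σ g : GL (Fin N) (RatFunField k n)) :
      Matrix (Fin N) (Fin N) (RatFunField k n)) =
      (g : Matrix (Fin N) (Fin N) (RatFunField k n)).map (endo σ) := rfl

variable (f : Cocycle (glAction N (endoHom k n)))

lemma Cocycle.map_one {M A : Type*} [Monoid M] [Group A] {φ : M →* Monoid.End A}
    (f : Cocycle φ) : f.toFun 1 = 1 := by
  have h := f.map_mul' 1 1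
  rw [mul_one, _root_.map_one, Monoid.End.coe_one, id] at h
  exact left_eq_mul.1 h

/-- The relation `t · s = s · t ^ s` between translations and scalars, read off on a cocycle. -/
lemma Cocycle.translation_scalar (t : Fin n → kˣ) {s : ℕ} (hs : 0 < s) :
    f.toFun (ofTrans t) * glAction N (endoHom k n) (ofTrans t) (f.toFun (ofNat k n s hs)) =
      f.toFun (ofNat k n s hs) *
        glAction N (endoHom k n) (ofNat k n s hs) (f.toFun (ofTrans (t ^ s))) := by
  rw [← f.map_mul', ← f.map_mul', ofTrans_mul_ofNat]

/-- A cocycle has bounded degree on torsion translations. With `s = l + 1`, the relation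
`f_{t ^ s}(x ^ s) = A(x)⁻¹ f_t(x) A(t x)` bounds `s` times the degree at `t ^ s` by the degree at
`t` plus a constant, and `t ↦ t ^ s` permutes the finite set of points of a given level. -/
lemma exists_boundedDegree_torsion (hl : 2 ≤ l) :
    ∃ d, ∀ t ∈ primaryTorsion k n l, BoundedDegree d
      (f.toFun (ofTrans t) : Matrix (Fin N) (Fin N) (RatFunField k n)) := by
  have hs : 0 < l + 1 := by omega
  set A := f.toFun (ofNat k n (l + 1) hs) with hA
  obtain ⟨c₁, hc₁⟩ := exists_boundedDegree (A : Matrix (Fin N) (Fin N) (RatFunField k n))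
  obtain ⟨c₂, hc₂⟩ := exists_boundedDegree
    ((A⁻¹ : GL (Fin N) (RatFunField k n)) : Matrix (Fin N) (Fin N) (RatFunField k n))
  refine ⟨c₂ + c₁, fun t ht => ?_⟩
  obtain ⟨m, hm⟩ := mem_primaryTorsion.1 ht
  have := finite_torsionLevel (k := k) (n := n) hl m
  classical
  have hex : ∃ D, ∀ u ∈ torsionLevel k n l m, BoundedDegree D
      (f.toFun (ofTrans u) : Matrix (Fin N) (Fin N) (RatFunField k n)) := by
    choose D hD using fun u : torsionLevel k n l m => exists_boundedDegree
      (f.toFun (ofTrans u.1) : Matrix (Fin N) (Fin N) (RatFunField k n))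
    obtain ⟨M, hM⟩ := (Set.finite_range D).bddAbove
    exact ⟨M, fun u hu => (hD ⟨u, hu⟩).mono (hM ⟨_, rfl⟩)⟩
  obtain ⟨D, hD, hmin⟩ : ∃ D, (∀ u ∈ torsionLevel k n l m, BoundedDegree D
      (f.toFun (ofTrans u) : Matrix (Fin N) (Fin N) (RatFunField k n))) ∧
      ∀ D' < D, ¬ ∀ u ∈ torsionLevel k n l m, BoundedDegree D'
      (f.toFun (ofTrans u) : Matrix (Fin N) (Fin N) (RatFunField k n)) :=
    ⟨Nat.find hex, Nat.find_spec hex, fun _ h => Nat.find_min hex h⟩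
  have hstep : ∀ u ∈ torsionLevel k n l m, BoundedDegree ((c₂ + D + c₁) / (l + 1))
      (f.toFun (ofTrans u) : Matrix (Fin N) (Fin N) (RatFunField k n)) := by
    intro u hu
    obtain ⟨v, hv, rfl⟩ := exists_pow_eq_of_mem_torsionLevel hu
    apply BoundedDegree.of_map_ofNat hs
    have h1 := f.translation_scalar v hs
    rw [← hA, ← inv_mul_eq_iff_eq_mul, ← mul_assoc] at h1
    have h2 := congrArg Units.val h1
    rw [Units.val_mul, Units.val_mul, coe_glAction, coe_glAction] at h2
    rw [← h2]
    exact (hc₂.mul (hD v hv)).mul (hc₁.map_ofTrans v)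
  have hle : D ≤ (c₂ + D + c₁) / (l + 1) := by
    by_contra! h
    exact hmin _ h hstep
  rw [Nat.le_div_iff_mul_le hs] at hle
  refine (hD t hm).mono ?_
  nlinarith

end Torsion

/-! ### Averaging denominators -/

section Averaging

open MvPolynomial

lemma dvd_of_forall_prime_pow_dvd {R : Type*} [CommRing R] [IsDomain R]
    [UniqueFactorizationMonoid R] {a b : R} (ha : a ≠ 0)
    (h : ∀ p : R, Prime p → ∀ e : ℕ, p ^ e ∣ a → p ^ e ∣ b) : a ∣ b :=
  (UniqueFactorizationMonoid.dvd_iff_emultiplicity_le ha).2 fun p hp =>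
    emultiplicity_le_emultiplicity_iff.2 fun e => h p hp e

lemma pow_dvd_sq_or_pow_dvd_sq {R : Type*} [CommRing R] [IsDomain R] {p a b : R} (hp : Prime p)
    {e : ℕ} (h : p ^ e ∣ a * b) : p ^ e ∣ a ^ 2 ∨ p ^ e ∣ b ^ 2 := by
  rw [pow_dvd_iff_le_emultiplicity] at *
  rw [pow_dvd_iff_le_emultiplicity]
  rw [emultiplicity_mul hp] at h
  rw [sq, sq, emultiplicity_mul hp, emultiplicity_mul hp]
  rcases le_total (emultiplicity p a) (emultiplicity p b) with hab | hab
  · exact Or.inr (h.trans (by gcongr))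
  · exact Or.inl (h.trans (by gcongr))

variable {k : Type*} [Field k] {n : ℕ}

/-- Let `Pr m` be a product of `h m` factors of degree at most `d`. Along an ultrafilter, the prime
powers `p ^ e` for which `e` is at most twice the average multiplicity of `p` in these factors are
recorded by a single polynomial of degree at most `2 d`: a polynomial `g` of largest degree such
that `g ^ h m` divides `(Pr m) ^ 2` for most `m`. -/
lemma exists_recurrent_divisor {U : Filter ℕ} [U.NeBot] {d : ℕ} {h : ℕ → ℕ} (hh : ∀ m, 0 < h m)
    {Pr : ℕ → MvPolynomial (Fin n) k} (hPr : ∀ m, Pr m ≠ 0)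
    (hdeg : ∀ m, (Pr m).totalDegree ≤ h m * d) :
    ∃ g : MvPolynomial (Fin n) k, g ≠ 0 ∧ g.totalDegree ≤ 2 * d ∧
      ∀ p, Prime p → ∀ e : ℕ, (∀ᶠ m in U, (p ^ e) ^ h m ∣ Pr m ^ 2) → p ^ e ∣ g := by
  classical
  let G : Set (MvPolynomial (Fin n) k) := {g | g ≠ 0 ∧ ∀ᶠ m in U, g ^ h m ∣ Pr m ^ 2}
  have hbound : ∀ g ∈ G, g.totalDegree ≤ 2 * d := by
    rintro g ⟨hg, hU⟩
    obtain ⟨m, hm⟩ := hU.exists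
    have h1 := totalDegree_le_of_dvd_of_isDomain hm (pow_ne_zero 2 (hPr m))
    rw [totalDegree_pow_of_isDomain hg, totalDegree_pow_of_isDomain (hPr m)] at h1
    have h2 : h m * g.totalDegree ≤ h m * (2 * d) := by
      have := hdeg m
      nlinarith
    exact Nat.le_of_mul_le_mul_left h2 (hh m)
  obtain ⟨g, hgG, hgmax⟩ : ∃ g ∈ G, ∀ g' ∈ G, g'.totalDegree ≤ g.totalDegree := by
    obtain ⟨g, hgG, hg⟩ := Nat.findGreatest_spec (P := fun D => ∃ g ∈ G, g.totalDegree = D)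
      (n := 2 * d) (Nat.zero_le _) (by
        exact ⟨1, ⟨one_ne_zero, by simp⟩, totalDegree_one⟩)
    refine ⟨g, hgG, fun g' hg' => ?_⟩
    rw [hg]
    exact Nat.le_findGreatest (hbound g' hg') ⟨g', hg', rfl⟩
  refine ⟨g, hgG.1, hbound g hgG, fun p hp e hpe => ?_⟩
  -- otherwise `p * g` has larger degree and the same property
  by_contra hdvd
  obtain ⟨a, g₀, hg₀, hpg₀⟩ : ∃ a g₀, g = p ^ a * g₀ ∧ ¬ p ∣ g₀ :=
    ⟨_, (FiniteMultiplicity.of_prime_left hp hgG.1).exists_eq_pow_mul_and_not_dvd⟩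
  have hae : a + 1 ≤ e := by
    by_contra! hlt
    exact hdvd (hg₀ ▸ (pow_dvd_pow p (by omega)).mul_right _)
  have hpg : p * g ∈ G := by
    refine ⟨mul_ne_zero hp.ne_zero hgG.1, ?_⟩
    filter_upwards [hgG.2, hpe] with m hm hpm
    have h1 : g₀ ^ h m ∣ Pr m ^ 2 :=
      (pow_dvd_pow_of_dvd (Dvd.intro_left _ hg₀.symm) _).trans hm
    obtain ⟨Y, hY⟩ := h1
    have h2 : p ^ ((a + 1) * h m) ∣ g₀ ^ h m * Y := by
      rw [← hY]
      refine dvd_trans ?_ hpm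
      rw [← pow_mul]
      exact pow_dvd_pow p (Nat.mul_le_mul_right _ hae)
    have h3 := hp.pow_dvd_of_dvd_mul_left _ (fun h => hpg₀ (hp.dvd_of_dvd_pow h)) h2
    rw [hY, hg₀, ← mul_assoc, ← pow_succ', mul_pow, ← pow_mul, mul_comm]
    exact mul_dvd_mul_left _ h3
  have h1 := hgmax _ hpg
  rw [totalDegree_mul_of_isDomain hp.ne_zero hgG.1] at h1
  have h2 : p.totalDegree = 0 := by omega
  have h3 := totalDegree_eq_zero_iff_eq_C.1 h2
  refine hp.not_isUnit ?_
  rw [h3]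
  refine (isUnit_iff_ne_zero.2 fun h0 => hp.ne_zero ?_).map C
  rw [h3, h0, C_0]

end Averaging

section Denominators

open MvPolynomial IntTorusEnd

variable {k : Type*} [Field k] {n N l : ℕ} (f : Cocycle (glAction N (endoHom k n)))

lemma Cocycle.translation_mul (t u : Fin n → kˣ) (i j : Fin N) :
    f.toFun (ofTrans (t * u)) i j =
      ∑ r, f.toFun (ofTrans t) i r * endo (ofTrans t) (f.toFun (ofTrans u) r j) := by
  rw [ofTrans_mul, f.map_mul']
  rfl

/-- After multiplication by one function `g` and by the translates of one function `g'`, the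
cocycle becomes polynomial on all torsion translations. The denominator of `f_ζ` divides
`Q_ω(x) Q_{ω⁻¹ζ}(ω x)` for every `ω`. The second factor is the value at `ζ x` of a denominator of
the inverse of `f_η`, where `η = ζ⁻¹ω`; averaging over the torsion points `ω` of a given level
therefore bounds the denominator by a divisor in `x` and a divisor in `ζ x`. -/
lemma exists_common_denominators (hl : 2 ≤ l) {d : ℕ}
    (hd : ∀ t ∈ primaryTorsion k n l, BoundedDegree d
      (f.toFun (ofTrans t) : Matrix (Fin N) (Fin N) (RatFunField k n))) :
    ∃ g g' : MvPolynomial (Fin n) k, g ≠ 0 ∧ g' ≠ 0 ∧ ∀ ζ ∈ primaryTorsion k n l, ∀ i j,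
      ∃ P : MvPolynomial (Fin n) k, P.totalDegree ≤ 5 * d ∧
        algebraMap _ (RatFunField k n) (g * rescale ζ g') * f.toFun (ofTrans ζ) i j =
          algebraMap _ _ P := by
  classical
  have hinj := IsFractionRing.injective (MvPolynomial (Fin n) k) (RatFunField k n)
  have hd' : ∀ t, ∃ Q : MvPolynomial (Fin n) k, Q ≠ 0 ∧ Q.totalDegree ≤ d ∧
      (t ∈ primaryTorsion k n l → ∀ i j, ∃ P : MvPolynomial (Fin n) k, P.totalDegree ≤ d ∧
        algebraMap _ (RatFunField k n) Q * f.toFun (ofTrans t) i j = algebraMap _ _ P) := by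
    intro t
    by_cases ht : t ∈ primaryTorsion k n l
    · obtain ⟨Q, hQ, hQd, hP⟩ := hd t ht
      exact ⟨Q, hQ, hQd, fun _ => hP⟩
    · exact ⟨1, one_ne_zero, by simp, fun h => absurd h ht⟩
  choose Q hQ hQd hQP using hd'
  have hfin : ∀ m, Fintype (torsionLevel k n l m) := fun m =>
    @Fintype.ofFinite _ (finite_torsionLevel hl m)
  let h : ℕ → ℕ := fun m => Fintype.card (torsionLevel k n l m)
  have hh : ∀ m, 0 < h m := fun m => Fintype.card_pos
  -- `Q' t` is a denominator of the inverse of `f_t`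
  let Q' : (Fin n → kˣ) → MvPolynomial (Fin n) k := fun t => rescale t (Q t⁻¹)
  have hQ' : ∀ t, Q' t ≠ 0 := fun t => rescale_ne_zero t (hQ _)
  let A : ℕ → MvPolynomial (Fin n) k := fun m => ∏ ω : torsionLevel k n l m, Q ω
  let B : ℕ → MvPolynomial (Fin n) k := fun m => ∏ ω : torsionLevel k n l m, Q' ω
  have hA : ∀ m, A m ≠ 0 := fun m => Finset.prod_ne_zero_iff.2 fun ω _ => hQ _
  have hB : ∀ m, B m ≠ 0 := fun m => Finset.prod_ne_zero_iff.2 fun ω _ => hQ' _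
  have hAd : ∀ m, (A m).totalDegree ≤ h m * d := fun m =>
    (totalDegree_finsetProd _ _).trans <| (Finset.sum_le_card_nsmul _ _ d fun ω _ => hQd _).trans
      (by simp [h])
  have hBd : ∀ m, (B m).totalDegree ≤ h m * d := fun m =>
    (totalDegree_finsetProd _ _).trans <| (Finset.sum_le_card_nsmul _ _ d fun ω _ =>
      (totalDegree_rescale _ _).trans_le (hQd _)).trans (by simp [h])
  let U : Ultrafilter ℕ := Filter.hyperfilter ℕ
  obtain ⟨g, hg, hgd, hgU⟩ := exists_recurrent_divisor (U := (U : Filter ℕ)) hh hA hAd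
  obtain ⟨g', hg', hg'd, hg'U⟩ := exists_recurrent_divisor (U := (U : Filter ℕ)) hh hB hBd
  refine ⟨g, g', hg, hg', fun ζ hζ i j => ?_⟩
  obtain ⟨m₀, hm₀⟩ := mem_primaryTorsion.1 hζ
  -- `b` is the reduced denominator of the entry
  obtain ⟨a, b, hab, hmk⟩ := IsFractionRing.exists_reduced_fraction (MvPolynomial (Fin n) k)
    (f.toFun (ofTrans ζ) i j : RatFunField k n)
  have hb0 : (b : MvPolynomial (Fin n) k) ≠ 0 := nonZeroDivisors.coe_ne_zero b
  have hbspec : f.toFun (ofTrans ζ) i j *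
      algebraMap _ (RatFunField k n) (b : MvPolynomial (Fin n) k) = algebraMap _ _ a := by
    rw [← hmk]
    exact IsLocalization.mk'_spec _ _ _
  have hbdvd : ∀ q p : MvPolynomial (Fin n) k,
      algebraMap _ (RatFunField k n) q * f.toFun (ofTrans ζ) i j = algebraMap _ _ p →
      (b : MvPolynomial (Fin n) k) ∣ q := by
    intro q p hqp
    have h1 : q * a = p * b := by
      apply hinj
      rw [map_mul, map_mul, ← hqp, ← hbspec, mul_assoc]
    exact hab.symm.dvd_of_dvd_mul_right (Dvd.intro_left _ h1.symm)
  have hbω : ∀ ω ∈ primaryTorsion k n l,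
      (b : MvPolynomial (Fin n) k) ∣ Q ω * rescale ω (Q (ω⁻¹ * ζ)) := by
    intro ω hω
    choose P hP hPQ using hQP ω hω
    choose P' hP' hPQ' using hQP (ω⁻¹ * ζ) (mul_mem (inv_mem hω) hζ)
    refine hbdvd _ (∑ r, P i r * rescale ω (P' r j)) ?_
    have h1 := f.translation_mul ω (ω⁻¹ * ζ) i j
    rw [mul_inv_cancel_left] at h1
    rw [h1, Finset.mul_sum, map_sum]
    refine Finset.sum_congr rfl fun r _ => ?_
    rw [map_mul, map_mul, ← hPQ, ← endo_ofTrans_algebraMap ω (P' r j), ← hPQ', map_mul,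
      endo_ofTrans_algebraMap]
    ring
  -- the product over a level containing `ζ`, reindexed by `ω = ζ η` in the second factor
  have hbm : ∀ m, m₀ ≤ m → (b : MvPolynomial (Fin n) k) ^ h m ∣ A m * rescale ζ (B m) := by
    intro m hm
    have hζm : ζ ∈ torsionLevel k n l m := torsionLevel_mono hm hm₀
    have h1 : rescale ζ (B m) =
        ∏ ω : torsionLevel k n l m, rescale (ω : Fin n → kˣ) (Q ((ω : Fin n → kˣ)⁻¹ * ζ)) := by
      rw [map_prod]
      refine Fintype.prod_equiv (Equiv.mulLeft ⟨ζ, hζm⟩) _ _ fun ω => ?_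
      simp only [Q', Equiv.coe_mulLeft, Subgroup.coe_mul, mul_inv_rev, inv_mul_cancel_right]
      rw [rescale_mul_apply]
    rw [h1, ← Finset.prod_mul_distrib]
    calc (b : MvPolynomial (Fin n) k) ^ h m
        = ∏ _ω : torsionLevel k n l m, (b : MvPolynomial (Fin n) k) := by simp [h]
      _ ∣ _ := Finset.prod_dvd_prod_of_dvd _ _ fun ω _ => hbω _ (mem_primaryTorsion.2 ⟨m, ω.2⟩)
  -- of the two exponents of `p` on the right, one is at least half of the exponent on the left
  have hbg : (b : MvPolynomial (Fin n) k) ∣ g * rescale ζ g' := by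
    refine dvd_of_forall_prime_pow_dvd hb0 fun p hp e hpe => ?_
    have h1 : ∀ᶠ m in (U : Filter ℕ),
        (p ^ e) ^ h m ∣ A m ^ 2 ∨ (p ^ e) ^ h m ∣ rescale ζ (B m) ^ 2 := by
      have h0 : ∀ᶠ m in (U : Filter ℕ), m₀ ≤ m :=
        (Filter.eventually_ge_atTop m₀).filter_mono Nat.hyperfilter_le_atTop
      filter_upwards [h0] with m hm
      rw [← pow_mul]
      exact pow_dvd_sq_or_pow_dvd_sq hp
        (by rw [pow_mul]; exact (pow_dvd_pow_of_dvd hpe _).trans (hbm m hm))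
    rcases Ultrafilter.eventually_or.1 h1 with h2 | h2
    · exact (hgU p hp e h2).mul_right _
    · have hp' : Prime (rescale ζ⁻¹ p) :=
        comap_prime (rescale ζ) (rescale ζ⁻¹) (rescale_inv_rescale ζ)
          (by rwa [rescale_rescale_inv])
      have h3 := hg'U _ hp' e (by
        filter_upwards [h2] with m hm
        have := map_dvd (rescale ζ⁻¹) hm
        rwa [map_pow, map_pow, map_pow, rescale_inv_rescale] at this)
      have h4 := map_dvd (rescale ζ) h3
      rw [map_pow, rescale_rescale_inv] at h4
      exact h4.mul_left _
  obtain ⟨c, hc⟩ := hbg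
  refine ⟨a * c, ?_, ?_⟩
  swap
  · rw [hc, map_mul, map_mul, ← hbspec]
    ring
  obtain ⟨P, hP, hPQ⟩ := hQP ζ hζ i j
  have h1 : a * c * Q ζ = g * rescale ζ g' * P := by
    apply hinj
    rw [hc]
    simp only [map_mul]
    rw [← hPQ, ← hbspec]
    ring
  by_cases hac : a * c = 0
  · rw [hac]
    simp
  have h2 := congrArg totalDegree h1
  rw [totalDegree_mul_of_isDomain hac (hQ ζ)] at h2
  have h3 := (totalDegree_mul (g * rescale ζ g') P).trans
    (add_le_add_left (totalDegree_mul g (rescale ζ g')) _)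
  rw [totalDegree_rescale] at h3
  omega

end Denominators

/-! ### Diagonalization on torsion translations -/

section Eigenbasis

open IntTorusEnd Module

lemma iSup_eigenspace_eq_top_of_pow_eq_one {k E : Type*} [Field k] [CharZero k] [AddCommGroup E]
    [Module k E] {T : End k E} {q : ℕ} (hq : 0 < q) {ξ : k} (hξ : IsPrimitiveRoot ξ q)
    (hT : T ^ q = 1) : ⨆ μ : k, T.eigenspace μ = ⊤ := by
  rw [eq_top_iff]
  intro v _
  have hξ0 : ξ ≠ 0 := hξ.ne_zero hq.ne'
  -- the projections of `v` to the eigenspaces, up to the factor `q`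
  let w : ℕ → E := fun i => ∑ j ∈ Finset.range q, (ξ⁻¹ ^ i) ^ j • (T ^ j) v
  have hw : ∀ i, w i ∈ T.eigenspace (ξ ^ i) := by
    intro i
    rw [End.mem_eigenspace_iff]
    have hc : (ξ⁻¹ ^ i) ^ q = 1 := by
      rw [← pow_mul, mul_comm, pow_mul, inv_pow ξ q, hξ.pow_eq_one, inv_one, one_pow]
    have h1 : (ξ⁻¹ ^ i) • T (w i) = w i := by
      have h2 : (ξ⁻¹ ^ i) • T (w i) =
          ∑ j ∈ Finset.range q, (ξ⁻¹ ^ i) ^ (j + 1) • (T ^ (j + 1)) v := by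
        simp only [w, map_sum, map_smul, Finset.smul_sum, smul_smul, pow_succ',
          Module.End.mul_apply]
      have h3 := Finset.sum_range_succ (fun j => (ξ⁻¹ ^ i) ^ j • (T ^ j) v) q
      rw [Finset.sum_range_succ', hT, hc, pow_zero, pow_zero] at h3
      rw [h2]
      exact add_right_cancel h3
    calc T (w i) = (ξ ^ i) • (ξ⁻¹ ^ i) • T (w i) := by
          rw [smul_smul, ← mul_pow, mul_inv_cancel₀ hξ0, one_pow, one_smul]
      _ = (ξ ^ i) • w i := by rw [h1]
  have hsum : ∑ i ∈ Finset.range q, w i = (q : k) • v := by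
    simp only [w]
    rw [Finset.sum_comm]
    have h1 : ∀ j ∈ Finset.range q, ∑ i ∈ Finset.range q, (ξ⁻¹ ^ i) ^ j • (T ^ j) v =
        if j = 0 then (q : k) • v else 0 := by
      intro j hj
      rw [← Finset.sum_smul]
      split_ifs with hj0
      · simp [hj0]
      · have h2 : ∑ i ∈ Finset.range q, (ξ⁻¹ ^ i) ^ j = 0 := by
          have h3 : ξ⁻¹ ^ j ≠ 1 := by
            rw [inv_pow, Ne, inv_eq_one]
            exact hξ.pow_ne_one_of_pos_of_lt hj0 (Finset.mem_range.1 hj)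
          have h4 := mul_neg_geom_sum (ξ⁻¹ ^ j) q
          rw [← pow_mul, mul_comm j q, pow_mul, inv_pow ξ q, hξ.pow_eq_one, inv_one, one_pow,
            sub_self] at h4
          rw [← (mul_eq_zero.1 h4).resolve_left (sub_ne_zero.2 h3.symm)]
          exact Finset.sum_congr rfl fun i _ => by rw [← pow_mul, ← pow_mul, mul_comm]
        rw [h2, zero_smul]
    rw [Finset.sum_congr rfl h1, Finset.sum_ite_eq' (Finset.range q) 0, if_pos (by simpa using hq)]
  have hq0 : (q : k) ≠ 0 := by exact_mod_cast hq.ne'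
  rw [← inv_smul_smul₀ hq0 v, ← hsum]
  exact Submodule.smul_mem _ _ (Submodule.sum_mem _ fun i _ =>
    Submodule.mem_iSup_of_mem (ξ ^ i) (hw i))

/-- Commuting automorphisms of finite order of a finite-dimensional space are simultaneously
diagonalizable when the field contains the needed roots of unity. -/
lemma iSup_iInf_eigenspace_eq_top {k E ι : Type*} [Field k] [CharZero k] [AddCommGroup E]
    [Module k E] [FiniteDimensional k E] {T : ι → End k E} (hcomm : ∀ i j, Commute (T i) (T j))
    (hT : ∀ i, ∃ q : ℕ, 0 < q ∧ (∃ ξ : k, IsPrimitiveRoot ξ q) ∧ T i ^ q = 1) :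
    ⨆ χ : ι → k, ⨅ i, (T i).eigenspace (χ i) = ⊤ := by
  have hss : ∀ i, (T i).IsSemisimple := by
    intro i
    obtain ⟨q, hq, -, hTq⟩ := hT i
    refine End.isSemisimple_of_squarefree_aeval_eq_zero (p := Polynomial.X ^ q - 1) ?_
      (by simp [hTq])
    exact (Polynomial.X_pow_sub_one_separable_iff.2 (by exact_mod_cast hq.ne')).squarefree
  have heq : ∀ i μ, (T i).maxGenEigenspace μ = (T i).eigenspace μ := fun i μ =>
    (End.isFinitelySemisimple_iff_isSemisimple.2 (hss i)).maxGenEigenspace_eq_eigenspace μ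
  have := End.iSup_iInf_maxGenEigenspace_eq_top_of_iSup_maxGenEigenspace_eq_top_of_commute T
    (fun i j _ => hcomm i j) (fun i => by
      obtain ⟨q, hq, ⟨ξ, hξ⟩, hTq⟩ := hT i
      simp only [heq]
      exact iSup_eigenspace_eq_top_of_pow_eq_one hq hξ hTq)
  simpa only [heq] using this

variable {k : Type*} [Field k] {n N l : ℕ} (f : Cocycle (glAction N (endoHom k n)))

/-- The semilinear action `v ↦ f_t · t(v)` of a translation on `L ^ N`. -/
noncomputable def semilinear (t : Fin n → kˣ) : End k (Fin N → RatFunField k n) where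
  toFun v := (f.toFun (ofTrans t) : Matrix (Fin N) (Fin N) (RatFunField k n)).mulVec
    fun i => endo (ofTrans t) (v i)
  map_add' v w := by
    rw [← Matrix.mulVec_add]
    congr 1
    funext i
    simp
  map_smul' c v := by
    rw [RingHom.id_apply, ← Matrix.mulVec_smul]
    congr 1
    funext i
    simp

lemma semilinear_apply (t : Fin n → kˣ) (v : Fin N → RatFunField k n) (i : Fin N) :
    semilinear f t v i = ∑ j, f.toFun (ofTrans t) i j * endo (ofTrans t) (v j) := rfl

lemma endo_ofTrans_mul (t u : Fin n → kˣ) (x : RatFunField k n) :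
    endo (ofTrans (t * u)) x = endo (ofTrans t) (endo (ofTrans u) x) := by
  rw [ofTrans_mul]
  exact DFunLike.congr_fun ((endoHom k n).map_mul (ofTrans t) (ofTrans u)) x

lemma endo_ofTrans_one (x : RatFunField k n) : endo (ofTrans 1) x = x :=
  DFunLike.congr_fun (endoHom k n).map_one x

lemma semilinear_mul (t u : Fin n → kˣ) :
    semilinear f (t * u) = semilinear f t * semilinear f u := by
  refine LinearMap.ext fun v => funext fun i => ?_
  simp only [Module.End.mul_apply, semilinear_apply, map_sum, f.translation_mul, Finset.sum_mul,
    Finset.mul_sum, map_mul, endo_ofTrans_mul]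
  rw [Finset.sum_comm]
  simp only [mul_assoc]

lemma semilinear_one : semilinear f (1 : Fin n → kˣ) = 1 := by
  refine LinearMap.ext fun v => funext fun i => ?_
  rw [semilinear_apply, ofTrans_one, f.map_one]
  simp [Matrix.one_apply, ← ofTrans_one, endo_ofTrans_one]

/-- The cocycle becomes diagonal on torsion translations in a suitable basis. The translates of the
vectors `g' e_j` lie in `g⁻¹ k[x]_{≤ d} ^ N`, hence span a finite-dimensional space, which the
torsion translations preserve and diagonalize. -/
lemma exists_eigenbasis [CharZero k] (hl : 2 ≤ l)
    (hprim : ∀ m : ℕ, ∃ ζ : k, IsPrimitiveRoot ζ (l ^ m)) :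
    ∃ (b : GL (Fin N) (RatFunField k n)) (χ : Fin N → primaryTorsion k n l → k),
      ∀ (ζ : primaryTorsion k n l) (i j : Fin N),
        ∑ r, f.toFun (ofTrans ζ) i r * endo (ofTrans ζ) (b r j) = χ j ζ • b i j := by
  obtain ⟨d, hd⟩ := exists_boundedDegree_torsion f hl
  obtain ⟨g, g', hg, hg', hgP⟩ := exists_common_denominators f hl hd
  have hinj := IsFractionRing.injective (MvPolynomial (Fin n) k) (RatFunField k n)
  have hg0 : algebraMap _ (RatFunField k n) g ≠ 0 := (map_ne_zero_iff _ hinj).2 hg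
  have hg'0 : algebraMap _ (RatFunField k n) g' ≠ 0 := (map_ne_zero_iff _ hinj).2 hg'
  let e : Fin N → Fin N → RatFunField k n := fun j => Pi.single j (algebraMap _ _ g')
  let U : Submodule k (Fin N → RatFunField k n) :=
    Submodule.span k (Set.range fun x : primaryTorsion k n l × Fin N => semilinear f x.1 (e x.2))
  let Φ : (Fin N → MvPolynomial.restrictTotalDegree (Fin n) k (5 * d)) →ₗ[k]
      (Fin N → RatFunField k n) :=
    { toFun := fun P i => (algebraMap _ (RatFunField k n) g)⁻¹ * algebraMap _ _ (P i).1
      map_add' := fun P Q => funext fun i => by simp [mul_add]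
      map_smul' := fun c P => funext fun i => by
        simp [Algebra.smul_def, IsScalarTower.algebraMap_apply k (MvPolynomial (Fin n) k)
          (RatFunField k n), mul_left_comm] }
  have hUΦ : U ≤ LinearMap.range Φ := by
    refine Submodule.span_le.2 ?_
    rintro _ ⟨⟨ζ, j⟩, rfl⟩
    choose P hP hPQ using fun i => hgP ζ ζ.2 i j
    refine ⟨fun i => ⟨P i, (MvPolynomial.mem_restrictTotalDegree _ _ _).2 (hP i)⟩,
      funext fun i => ?_⟩
    change (algebraMap _ (RatFunField k n) g)⁻¹ * algebraMap _ _ (P i) = semilinear f ζ (e j) i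
    rw [← hPQ, semilinear_apply, Finset.sum_eq_single j]
    · simp only [e, Pi.single_eq_same, endo_ofTrans_algebraMap, map_mul]
      field_simp
    · intro r _ hr
      simp [e, Pi.single_eq_of_ne hr]
    · simp
  have hUfin : FiniteDimensional k U := Submodule.finiteDimensional_of_le hUΦ
  have hUinv : ∀ ζ : primaryTorsion k n l, ∀ v ∈ U, semilinear f ζ v ∈ U := by
    intro ζ v hv
    refine Submodule.span_induction (p := fun v _ => semilinear f ζ v ∈ U) ?_ ?_ ?_ ?_ hv
    · rintro _ ⟨⟨ω, j⟩, rfl⟩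
      refine Submodule.subset_span ⟨⟨ζ * ω, j⟩, ?_⟩
      simp only [Subgroup.coe_mul, semilinear_mul, Module.End.mul_apply]
    · simp
    · intro v w _ _ hv hw
      rw [map_add]
      exact add_mem hv hw
    · intro c v _ hv
      rw [map_smul]
      exact U.smul_mem c hv
  let T : primaryTorsion k n l → End k U := fun ζ => (semilinear f ζ).restrict (hUinv ζ)
  have hTapp : ∀ ζ (u : U), (T ζ u : Fin N → RatFunField k n) = semilinear f ζ u := fun _ _ => rfl
  have hTpow : ∀ (ζ : primaryTorsion k n l) (q : ℕ) (u : U),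
      ((T ζ ^ q) u : Fin N → RatFunField k n) = semilinear f ((ζ : Fin n → kˣ) ^ q) u := by
    intro ζ q
    induction q with
    | zero => simp [semilinear_one]
    | succ q ih =>
      intro u
      rw [pow_succ, Module.End.mul_apply, ih, hTapp, pow_succ, semilinear_mul, Module.End.mul_apply]
  have htop := iSup_iInf_eigenspace_eq_top (T := T)
    (fun ζ ω => LinearMap.ext fun u => Subtype.ext (by
      simp only [Module.End.mul_apply, hTapp]
      rw [← Module.End.mul_apply, ← semilinear_mul, mul_comm, semilinear_mul,
        Module.End.mul_apply]))
    (fun ζ => by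
      obtain ⟨m, hm⟩ := mem_primaryTorsion.1 ζ.2
      refine ⟨l ^ m, pow_pos (by omega) m, hprim m, LinearMap.ext fun u => Subtype.ext ?_⟩
      rw [hTpow, mem_torsionLevel.1 hm, semilinear_one]
      rfl)
  let S : Set (Fin N → RatFunField k n) :=
    {v | ∃ χ : primaryTorsion k n l → k, ∀ ζ : primaryTorsion k n l, semilinear f ζ v = χ ζ • v}
  have hUS : U ≤ Submodule.span k S := by
    rw [← Submodule.range_subtype U, LinearMap.range_eq_map, ← htop, Submodule.map_iSup]
    refine iSup_le fun χ => ?_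
    rintro _ ⟨u, hu, rfl⟩
    refine Submodule.subset_span ⟨χ, fun ζ => ?_⟩
    have h1 := End.mem_eigenspace_iff.1 ((Submodule.mem_iInf _).1 hu ζ)
    exact congrArg Subtype.val h1
  have hspan : ⊤ ≤ Submodule.span (RatFunField k n) S := by
    rw [← (Pi.basisFun (RatFunField k n) (Fin N)).span_eq]
    refine Submodule.span_le.2 ?_
    rintro _ ⟨j, rfl⟩
    have h1 : e j ∈ U := by
      refine Submodule.subset_span ⟨⟨1, j⟩, ?_⟩
      simp [semilinear_one]
    have h2 : e j ∈ Submodule.span (RatFunField k n) S :=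
      Submodule.span_le_restrictScalars k (RatFunField k n) S (hUS h1)
    have h3 : Pi.basisFun (RatFunField k n) (Fin N) j =
        (algebraMap _ (RatFunField k n) g')⁻¹ • e j := by
      simp only [Pi.basisFun_apply, e]
      rw [← Pi.single_smul, smul_eq_mul, inv_mul_cancel₀ hg'0]
    rw [h3]
    exact Submodule.smul_mem _ _ h2
  let B₀ := Basis.ofSpan hspan
  let B : Basis (Fin N) (RatFunField k n) (Fin N → RatFunField k n) :=
    B₀.reindex (B₀.indexEquiv (Pi.basisFun (RatFunField k n) (Fin N)))
  have hBS : ∀ j, B j ∈ S := fun j => by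
    rw [Basis.reindex_apply]
    exact Basis.ofSpan_subset hspan ⟨_, rfl⟩
  choose χ hχ using hBS
  let E := Pi.basisFun (RatFunField k n) (Fin N)
  let b : GL (Fin N) (RatFunField k n) :=
    ⟨E.toMatrix B, B.toMatrix E, E.toMatrix_mul_toMatrix_flip B, B.toMatrix_mul_toMatrix_flip E⟩
  have hb : ∀ i j, b i j = B j i := fun i j => rfl
  refine ⟨b, χ, fun ζ i j => ?_⟩
  simp only [hb]
  exact congrFun (hχ j ζ) i

end Eigenbasis

/-! ### Eigenfunctions of the torsion translations -/

section Eigenfunctions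

open MvPolynomial IntTorusEnd

variable {k : Type*} [Field k] {n l : ℕ}

lemma endo_ofTrans_laurent (t : Fin n → kˣ) (e : Fin n → ℤ) :
    endo (ofTrans t) (laurent e : (RatFunField k n)ˣ) =
      ((∏ i, t i ^ e i : kˣ) : k) • ((laurent e : (RatFunField k n)ˣ) : RatFunField k n) := by
  have h : Units.map (endo (ofTrans t) : RatFunField k n →* RatFunField k n) (laurent e) =
      Units.map (algebraMap k (RatFunField k n)).toMonoidHom (∏ i, t i ^ e i) * laurent e := by
    rw [laurent, map_prod, map_prod, ← Finset.prod_mul_distrib]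
    refine Finset.prod_congr rfl fun i _ => ?_
    rw [map_zpow, map_zpow, ← mul_zpow]
    congr 1
    apply Units.ext
    refine (endo_coord _ i).trans ?_
    rw [coordImage, ofTrans_mat, prod_zpow_one]
    rfl
  rw [Algebra.smul_def]
  exact congrArg Units.val h

/-- Torsion points separate characters of the torus. -/
lemma eq_of_forall_torsion_prod_zpow_eq (hl : 2 ≤ l)
    (hprim : ∀ m : ℕ, ∃ ζ : k, IsPrimitiveRoot ζ (l ^ m)) {e e' : Fin n → ℤ}
    (h : ∀ t ∈ primaryTorsion k n l, ∏ i, t i ^ e i = ∏ i, t i ^ e' i) : e = e' := by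
  funext i
  obtain ⟨m, hm⟩ : ∃ m : ℕ, (e i - e' i).natAbs < l ^ m :=
    ⟨_, Nat.lt_pow_self (n := (e i - e' i).natAbs) (by omega)⟩
  obtain ⟨ζ, hζ⟩ := hprim m
  have hlm : l ^ m ≠ 0 := pow_ne_zero _ (by omega)
  obtain ⟨z, rfl⟩ : IsUnit ζ := hζ.isUnit hlm
  have hz : IsPrimitiveRoot z (l ^ m) := IsPrimitiveRoot.coe_units_iff.1 hζ
  have hmem : Pi.mulSingle i z ∈ primaryTorsion k n l :=
    ⟨m, by rw [← Pi.mulSingle_pow, hz.pow_eq_one, Pi.mulSingle_one]⟩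
  have hprod : ∀ c : Fin n → ℤ,
      ∏ j, (Pi.mulSingle i z : Fin n → kˣ) j ^ c j = z ^ c i := by
    intro c
    rw [Finset.prod_eq_single i]
    · rw [Pi.mulSingle_eq_same]
    · intro j _ hj
      rw [Pi.mulSingle_eq_of_ne hj, one_zpow]
    · simp
  have h1 := h _ hmem
  rw [hprod, hprod] at h1
  have h2 : z ^ (e i - e' i) = 1 := by rw [zpow_sub, h1, mul_inv_cancel]
  have h3 := (hz.zpow_eq_one_iff_dvd _).1 h2
  have h4 := Int.eq_zero_of_dvd_of_natAbs_lt_natAbs h3 (by rwa [Int.natAbs_natCast])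
  omega

/-- A polynomial that divides all its translates by torsion points is a monomial. -/
lemma eq_monomial_of_forall_dvd_rescale (hl : 2 ≤ l)
    (hprim : ∀ m : ℕ, ∃ ζ : k, IsPrimitiveRoot ζ (l ^ m)) {p : MvPolynomial (Fin n) k}
    (hp : p ≠ 0) (h : ∀ t ∈ primaryTorsion k n l, p ∣ rescale t p) :
    ∃ m c, c ≠ 0 ∧ p = monomial m c := by
  obtain ⟨m, hm⟩ := ne_zero_iff.1 hp
  refine ⟨m, coeff m p, hm, ?_⟩
  ext m'
  rw [coeff_monomial]
  split_ifs with hmm'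
  · rw [hmm']
  by_contra hm'
  apply hmm'
  have key : (fun i => (m i : ℤ)) = fun i => (m' i : ℤ) := by
    refine eq_of_forall_torsion_prod_zpow_eq hl hprim fun t ht => ?_
    obtain ⟨q, hq⟩ := h t ht
    have hq0 : q ≠ 0 := by
      rintro rfl
      exact rescale_ne_zero t hp (by rw [hq, mul_zero])
    have h1 := congrArg totalDegree hq
    rw [totalDegree_rescale, totalDegree_mul_of_isDomain hp hq0] at h1
    have h2 := totalDegree_eq_zero_iff_eq_C.1 (by omega : q.totalDegree = 0)
    have h2' : rescale t p = C (coeff 0 q) * p := by rw [mul_comm, ← h2, hq]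
    have h3 : ∀ r, coeff r p ≠ 0 → ∏ i, (t i : k) ^ r i = coeff 0 q := by
      intro r hr
      have := congrArg (coeff r) h2'
      rw [coeff_rescale, coeff_C_mul] at this
      exact mul_right_cancel₀ hr this
    apply Units.ext
    simp only [zpow_natCast, Units.coe_prod, Units.val_pow_eq_pow_val]
    rw [h3 m hm, h3 m' hm']
  ext i
  exact_mod_cast congrFun key i

/-- The eigenfunctions of the torsion translations are the multiples of Laurent monomials. -/
lemma exists_eq_smul_laurent (hl : 2 ≤ l)
    (hprim : ∀ m : ℕ, ∃ ζ : k, IsPrimitiveRoot ζ (l ^ m)) {x : RatFunField k n} (hx : x ≠ 0)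
    (h : ∀ t ∈ primaryTorsion k n l, ∃ c : k, endo (ofTrans t) x = c • x) :
    ∃ (c : k) (e : Fin n → ℤ), x = c • ((laurent e : (RatFunField k n)ˣ) : RatFunField k n) := by
  have hinj := IsFractionRing.injective (MvPolynomial (Fin n) k) (RatFunField k n)
  obtain ⟨a, ⟨b, hb⟩, hab, hmk⟩ :=
    IsFractionRing.exists_reduced_fraction (MvPolynomial (Fin n) k) x
  change IsRelPrime a b at hab
  have hb0 : b ≠ 0 := nonZeroDivisors.ne_zero hb
  have hb1 : algebraMap _ (RatFunField k n) b ≠ 0 :=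
    (map_ne_zero_iff _ hinj).2 hb0
  have hx' : x * algebraMap _ (RatFunField k n) b =
      algebraMap _ _ a := by
    rw [← hmk]
    exact IsLocalization.mk'_spec _ _ _
  have ha0 : a ≠ 0 := by
    rintro rfl
    rw [map_zero] at hx'
    exact (mul_ne_zero hx hb1) hx'
  have hrel : ∀ t ∈ primaryTorsion k n l, ∃ c : k, c ≠ 0 ∧
      rescale t a * b = C c * a * rescale t b := by
    intro t ht
    obtain ⟨c, hc⟩ := h t ht
    have h1 : rescale t a * b = C c * a * rescale t b := by
      apply hinj
      simp only [map_mul]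
      rw [← endo_ofTrans_algebraMap, ← endo_ofTrans_algebraMap, ← hx', map_mul, hc,
        Algebra.smul_def, IsScalarTower.algebraMap_apply k (MvPolynomial (Fin n) k),
        MvPolynomial.algebraMap_eq]
      ring
    refine ⟨c, ?_, h1⟩
    rintro rfl
    rw [C_0, zero_mul, zero_mul] at h1
    exact mul_ne_zero (rescale_ne_zero t ha0) hb0 h1
  obtain ⟨m, c, -, hm⟩ := eq_monomial_of_forall_dvd_rescale hl hprim ha0 fun t ht => by
    obtain ⟨c, -, hc⟩ := hrel t ht
    exact hab.dvd_of_dvd_mul_right (Dvd.intro (C c * rescale t b) (by rw [hc]; ring))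
  obtain ⟨m', c', hc', hm'⟩ := eq_monomial_of_forall_dvd_rescale hl hprim hb0 fun t ht => by
    obtain ⟨c, hc0, hc⟩ := hrel t ht
    refine hab.symm.dvd_of_dvd_mul_right (Dvd.intro (C c⁻¹ * rescale t a) ?_)
    calc b * (C c⁻¹ * rescale t a) = C c⁻¹ * (rescale t a * b) := by ring
      _ = C (c⁻¹ * c) * a * rescale t b := by rw [hc, C_mul]; ring
      _ = rescale t b * a := by rw [inv_mul_cancel₀ hc0, C_1]; ring
  have hmon : ∀ (r : Fin n →₀ ℕ) (s : k), algebraMap _ (RatFunField k n) (monomial r s) =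
      s • ((laurent (fun i => (r i : ℤ)) : (RatFunField k n)ˣ) : RatFunField k n) := by
    intro r s
    rw [laurent_natCast, ← mul_one s, ← smul_eq_mul, ← smul_monomial, Algebra.smul_def,
      Algebra.smul_def, map_mul, ← IsScalarTower.algebraMap_apply]
    simp
  refine ⟨c * c'⁻¹, (fun i => (m i : ℤ)) - fun i => (m' i : ℤ), ?_⟩
  apply mul_right_cancel₀ hb1
  rw [hx', hm, hm', hmon, hmon, smul_mul_smul_comm, mul_assoc, inv_mul_cancel₀ hc', mul_one,
    ← Units.val_mul, ← laurent_add, sub_add_cancel]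

/-- The rational functions invariant under the torsion translations are the constants. -/
lemma exists_algebraMap_eq_of_invariant (hl : 2 ≤ l)
    (hprim : ∀ m : ℕ, ∃ ζ : k, IsPrimitiveRoot ζ (l ^ m)) {x : RatFunField k n}
    (h : ∀ t ∈ primaryTorsion k n l, endo (ofTrans t) x = x) :
    ∃ c : k, algebraMap k (RatFunField k n) c = x := by
  by_cases hx : x = 0
  · exact ⟨0, by rw [hx, map_zero]⟩
  obtain ⟨c, e, hce⟩ := exists_eq_smul_laurent hl hprim hx fun t ht => ⟨1, by rw [h t ht, one_smul]⟩
  have hc : c ≠ 0 := by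
    rintro rfl
    exact hx (by rw [hce, zero_smul])
  have he : e = 0 := by
    refine eq_of_forall_torsion_prod_zpow_eq hl hprim fun t ht => ?_
    have h1 := h t ht
    rw [hce, map_smul, endo_ofTrans_laurent, smul_smul] at h1
    have h2 := smul_left_injective k (Units.ne_zero (laurent e : (RatFunField k n)ˣ)) h1
    apply Units.ext
    simpa [hc] using h2
  refine ⟨c, ?_⟩
  rw [hce, he, Algebra.smul_def]
  simp [laurent]

end Eigenfunctions

/-! ### Trivialization on torsion translations -/

section Twist

variable {M A : Type*} [Monoid M] [Group A] {φ : M →* Monoid.End A}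

/-- The cocycle `σ ↦ b⁻¹ · f σ · σ b`. -/
def Cocycle.twist (f : Cocycle φ) (b : A) : Cocycle φ where
  toFun σ := b⁻¹ * f.toFun σ * φ σ b
  map_mul' σ τ := by
    have h : φ (σ * τ) b = φ σ (φ τ b) := by
      rw [map_mul]
      rfl
    rw [f.map_mul', h, map_mul, map_mul, map_inv]
    group

lemma Cocycle.twist_toFun (f : Cocycle φ) (b : A) (σ : M) :
    (f.twist b).toFun σ = b⁻¹ * f.toFun σ * φ σ b := rfl

end Twist

/-- A finite subset of a commutative group contained in its image under every power map with
positive exponent is trivial: it is preserved by all power maps, so its elements have finite order,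
and a common multiple of the orders maps it onto itself. -/
lemma eq_one_of_forall_exists_eq_pow {G ι : Type*} [CommGroup G] [Fintype ι] (c : ι → G)
    (h : ∀ s : ℕ, 0 < s → ∀ i, ∃ j, c i = c j ^ s) (i : ι) : c i = 1 := by
  classical
  let X : Finset G := Finset.univ.image c
  have hX : ∀ s : ℕ, 0 < s → X.image (· ^ s) = X := by
    intro s hs
    refine (Finset.eq_of_subset_of_card_le (fun x hx => ?_) Finset.card_image_le).symm
    obtain ⟨i, -, rfl⟩ := Finset.mem_image.1 hx
    obtain ⟨j, hj⟩ := h s hs i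
    exact Finset.mem_image.2 ⟨c j, Finset.mem_image_of_mem c (Finset.mem_univ j), hj.symm⟩
  have hfin : ∀ j, IsOfFinOrder (c j) := by
    intro j
    rw [← finite_powers]
    refine (insert 1 X).finite_toSet.subset ?_
    rintro _ ⟨s, rfl⟩
    rcases Nat.eq_zero_or_pos s with rfl | hs
    · simp
    · refine Finset.mem_coe.2 (Finset.mem_insert_of_mem ?_)
      rw [← hX s hs]
      exact Finset.mem_image_of_mem _ (Finset.mem_image_of_mem c (Finset.mem_univ j))
  obtain ⟨j, hj⟩ := h (∏ j, orderOf (c j)) (Finset.prod_pos fun j _ => (hfin j).orderOf_pos) i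
  rw [hj]
  exact orderOf_dvd_iff_pow_eq_one.1 (Finset.dvd_prod_of_mem _ (Finset.mem_univ j))

lemma mem_of_forall_exists_inv_mul_pow_mem {G ι : Type*} [CommGroup G] [Fintype ι]
    (W : Subgroup G) (c : ι → G) (h : ∀ s : ℕ, 0 < s → ∀ i, ∃ j, (c i)⁻¹ * c j ^ s ∈ W) (i : ι) :
    c i ∈ W := by
  rw [← QuotientGroup.eq_one_iff]
  refine eq_one_of_forall_exists_eq_pow (fun i => (c i : G ⧸ W)) (fun s hs i => ?_) i
  obtain ⟨j, hj⟩ := h s hs i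
  exact ⟨j, QuotientGroup.eq.2 hj⟩

section Trivialization

open IntTorusEnd

variable {k : Type*} [Field k] {n N l : ℕ}

/-- The restrictions `ζ ↦ ζ ^ e` to the torsion points of the algebraic characters of the torus,
as a subgroup of the group of all functions. -/
def algebraicCharacters (k : Type*) [Field k] (n l : ℕ) :
    Subgroup (primaryTorsion k n l → kˣ) where
  carrier := {ψ | ∃ e : Fin n → ℤ, ∀ ζ, ψ ζ = ∏ i, (ζ : Fin n → kˣ) i ^ e i}
  one_mem' := ⟨0, fun ζ => by simp⟩
  mul_mem' := by
    rintro ψ ψ' ⟨e, he⟩ ⟨e', he'⟩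
    exact ⟨e + e', fun ζ => by simp [he, he', zpow_add, Finset.prod_mul_distrib]⟩
  inv_mem' := by
    rintro ψ ⟨e, he⟩
    exact ⟨-e, fun ζ => by simp [he]⟩

/-- If a cocycle is diagonal on torsion translations, its diagonal characters are algebraic. The
value of the cocycle at the scalar `s` intertwines the characters with their `s`-th powers, up to
algebraic characters; so modulo these the finite set of characters is contained in its image under
every power map. -/
lemma exists_exponent (hl : 2 ≤ l) (hprim : ∀ m : ℕ, ∃ ζ : k, IsPrimitiveRoot ζ (l ^ m))
    (f : Cocycle (glAction N (endoHom k n))) (χ : Fin N → primaryTorsion k n l → k)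
    (hχ : ∀ (ζ : primaryTorsion k n l) (i j : Fin N), f.toFun (ofTrans ζ) i j =
      if i = j then algebraMap k (RatFunField k n) (χ j ζ) else 0) (j : Fin N) :
    ∃ e : Fin n → ℤ, ∀ ζ : primaryTorsion k n l,
      χ j ζ = ((∏ i, (ζ : Fin n → kˣ) i ^ e i : kˣ) : k) := by
  have hinj := (algebraMap k (RatFunField k n)).injective
  have hone : ∀ j, χ j 1 = 1 := by
    intro j
    have h1 := hχ 1 j j
    rw [if_pos rfl, Subgroup.coe_one, ofTrans_one, f.map_one, Units.val_one,
      Matrix.one_apply_eq] at h1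
    exact hinj (by rw [← h1, map_one])
  have hmul : ∀ j ζ ω, χ j (ζ * ω) = χ j ζ * χ j ω := by
    intro j ζ ω
    apply hinj
    have h1 := f.translation_mul (ζ : Fin n → kˣ) ω j j
    rw [← Subgroup.coe_mul, hχ, if_pos rfl, Finset.sum_eq_single j] at h1
    · rw [h1, hχ, hχ, if_pos rfl, if_pos rfl, AlgHom.commutes, map_mul]
    · intro r _ hr
      rw [hχ, if_neg hr.symm, zero_mul]
    · simp
  let X : Fin N → (primaryTorsion k n l → kˣ) := fun j =>
    (MonoidHom.toHomUnits (⟨⟨χ j, hone j⟩, hmul j⟩ : primaryTorsion k n l →* k) : _ → kˣ)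
  have hXpow : ∀ j ζ (s : ℕ), X j (ζ ^ s) = X j ζ ^ s := fun j ζ s => map_pow _ ζ s
  have hXχ : ∀ j ζ, ((X j ζ : kˣ) : k) = χ j ζ := fun j ζ => rfl
  have hc : ∀ s : ℕ, 0 < s → ∀ i, ∃ j, (X i)⁻¹ * X j ^ s ∈ algebraicCharacters k n l := by
    intro s hs i
    set A := f.toFun (ofNat k n s hs) with hA
    obtain ⟨j, hj⟩ : ∃ j, A i j ≠ 0 := by
      by_contra! h0
      have h1 : (A * A⁻¹ : GL (Fin N) (RatFunField k n)) i i = 1 := by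
        rw [mul_inv_cancel, Units.val_one, Matrix.one_apply_eq]
      rw [Units.val_mul, Matrix.mul_apply] at h1
      simp [h0] at h1
    have hrel : ∀ ζ : primaryTorsion k n l, endo (ofTrans ζ) (A i j) =
        ((((X i)⁻¹ * X j ^ s) ζ : kˣ) : k) • A i j := by
      intro ζ
      have h1 := congrArg (fun g : GL (Fin N) (RatFunField k n) => g i j)
        (f.translation_scalar (ζ : Fin n → kˣ) hs)
      simp only [← hA, Units.val_mul, Matrix.mul_apply, coe_glAction, Matrix.map_apply] at h1
      rw [Finset.sum_eq_single i, Finset.sum_eq_single j, ← Subgroup.coe_pow, hχ, hχ, if_pos rfl,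
        if_pos rfl, AlgHom.commutes, ← hXχ, ← hXχ, hXpow] at h1
      · have h2 : algebraMap k (RatFunField k n) (X i ζ : kˣ) ≠ 0 :=
          (map_ne_zero_iff _ hinj).2 (Units.ne_zero _)
        rw [Algebra.smul_def]
        simp only [Pi.mul_apply, Pi.pow_apply, Pi.inv_apply, Units.val_mul,
          Units.val_pow_eq_pow_val, Units.val_inv_eq_inv_val, map_mul, map_inv₀, map_pow] at h1 ⊢
        field_simp
        rw [mul_comm, h1, mul_comm]
      · intro r _ hr
        rw [← Subgroup.coe_pow, hχ, if_neg hr, map_zero, mul_zero]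
      · simp
      · intro r _ hr
        rw [hχ, if_neg hr.symm, zero_mul]
      · simp
    obtain ⟨a, e, hae⟩ := exists_eq_smul_laurent hl hprim hj fun t ht => ⟨_, hrel ⟨t, ht⟩⟩
    refine ⟨j, e, fun ζ => ?_⟩
    have ha : a ≠ 0 := by
      rintro rfl
      exact hj (by rw [hae, zero_smul])
    have h1 := hrel ζ
    rw [hae, map_smul, endo_ofTrans_laurent, smul_smul, smul_smul, mul_comm] at h1
    have h2 := smul_left_injective k (Units.ne_zero (laurent e : (RatFunField k n)ˣ)) h1
    have h3 := mul_right_cancel₀ ha h2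
    exact Units.ext h3.symm
  obtain ⟨e, he⟩ := mem_of_forall_exists_inv_mul_pow_mem _ X hc j
  exact ⟨e, fun ζ => by rw [← he, hXχ]⟩

/-- Every cocycle is cohomologous to one that is trivial on torsion translations. -/
lemma exists_twist_torsion_eq_one [CharZero k] (hl : 2 ≤ l)
    (hprim : ∀ m : ℕ, ∃ ζ : k, IsPrimitiveRoot ζ (l ^ m))
    (f : Cocycle (glAction N (endoHom k n))) :
    ∃ b, ∀ ζ ∈ primaryTorsion k n l, (f.twist b).toFun (ofTrans ζ) = 1 := by
  obtain ⟨b, χ, hb⟩ := exists_eigenbasis f hl hprim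
  have hdiag : ∀ ζ : primaryTorsion k n l, ((f.twist b).toFun (ofTrans ζ) :
      Matrix (Fin N) (Fin N) (RatFunField k n)) =
      Matrix.diagonal fun j => algebraMap k (RatFunField k n) (χ j ζ) := by
    intro ζ
    have h1 : ((f.toFun (ofTrans ζ) * glAction N (endoHom k n) (ofTrans ζ) b :
        GL (Fin N) (RatFunField k n)) : Matrix (Fin N) (Fin N) (RatFunField k n)) =
        b * Matrix.diagonal fun j => algebraMap k (RatFunField k n) (χ j ζ) := by
      ext i j
      rw [Matrix.mul_diagonal, mul_comm, ← Algebra.smul_def, ← hb ζ i j]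
      rfl
    rw [Cocycle.twist_toFun, mul_assoc, Units.val_mul, h1, ← mul_assoc, ← Units.val_mul,
      inv_mul_cancel, Units.val_one, one_mul]
  choose e he using exists_exponent hl hprim (f.twist b) χ fun ζ i j => by
    rw [hdiag, Matrix.diagonal_apply]
    split_ifs with h
    · rw [h]
    · rfl
  have hinv : ∀ e : Fin n → ℤ, (laurent (-e) * laurent e : (RatFunField k n)ˣ) = 1 := fun e => by
    rw [← laurent_add, neg_add_cancel]
    simp [laurent]
  have hinv' : ∀ e : Fin n → ℤ, (laurent e * laurent (-e) : (RatFunField k n)ˣ) = 1 := fun e => by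
    rw [mul_comm, hinv]
  -- rescaling the `j`-th basis vector by `x ^ (-e j)` removes the character `ζ ^ e j`
  let D : GL (Fin N) (RatFunField k n) :=
    ⟨Matrix.diagonal fun j => ((laurent (-e j) : (RatFunField k n)ˣ) : RatFunField k n),
      Matrix.diagonal fun j => ((laurent (e j) : (RatFunField k n)ˣ) : RatFunField k n), by
      rw [Matrix.diagonal_mul_diagonal]
      simp only [← Units.val_mul, hinv, Units.val_one, Matrix.diagonal_one], by
      rw [Matrix.diagonal_mul_diagonal]
      simp only [← Units.val_mul, hinv', Units.val_one, Matrix.diagonal_one]⟩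
  refine ⟨b * D, fun ζ hζ => ?_⟩
  have htwist : (f.twist (b * D)).toFun (ofTrans ζ) = ((f.twist b).twist D).toFun (ofTrans ζ) := by
    simp only [Cocycle.twist_toFun, mul_inv_rev, map_mul, mul_assoc]
  rw [htwist, Cocycle.twist_toFun, mul_assoc, inv_mul_eq_one]
  apply Units.ext
  rw [Units.val_mul, hdiag ⟨ζ, hζ⟩, coe_glAction]
  change Matrix.diagonal _ = Matrix.diagonal _ * (Matrix.diagonal _).map _
  rw [Matrix.diagonal_map (map_zero _), Matrix.diagonal_mul_diagonal]
  congr 1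
  funext j
  rw [endo_ofTrans_laurent, Algebra.smul_def, ← mul_assoc, ← map_mul, he, ← Units.val_mul,
    ← Finset.prod_mul_distrib]
  simp

/-- The matrices invariant under the torsion translations are constant. -/
lemma exists_map_eq_of_invariant (hl : 2 ≤ l)
    (hprim : ∀ m : ℕ, ∃ ζ : k, IsPrimitiveRoot ζ (l ^ m)) {b : GL (Fin N) (RatFunField k n)}
    (hb : ∀ ζ ∈ primaryTorsion k n l, glAction N (endoHom k n) (ofTrans ζ) b = b) :
    ∃ g : GL (Fin N) k, Matrix.GeneralLinearGroup.map (algebraMap k (RatFunField k n)) g = b := by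
  have hconst : ∀ b : GL (Fin N) (RatFunField k n),
      (∀ ζ ∈ primaryTorsion k n l, glAction N (endoHom k n) (ofTrans ζ) b = b) →
      ∃ g : Matrix (Fin N) (Fin N) k, g.map (algebraMap k (RatFunField k n)) = b := by
    intro b hb
    choose g hg using fun i j => exists_algebraMap_eq_of_invariant hl hprim (x := b i j)
      fun ζ hζ => congrArg (fun c : GL (Fin N) (RatFunField k n) => c i j) (hb ζ hζ)
    exact ⟨Matrix.of g, Matrix.ext hg⟩
  obtain ⟨g, hg⟩ := hconst b hb
  obtain ⟨g', hg'⟩ := hconst b⁻¹ fun ζ hζ => by rw [map_inv, hb ζ hζ]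
  have hinj : Function.Injective (fun M : Matrix (Fin N) (Fin N) k =>
      M.map (algebraMap k (RatFunField k n))) :=
    Matrix.map_injective (algebraMap k (RatFunField k n)).injective
  refine ⟨⟨g, g', hinj ?_, hinj ?_⟩, Units.ext hg⟩
  · simp only [Matrix.map_mul, hg, hg', ← Units.val_mul, mul_inv_cancel]
    simp
  · simp only [Matrix.map_mul, hg, hg', ← Units.val_mul, inv_mul_cancel]
    simp

/-- A cocycle that is trivial on torsion translations has constant values. -/
lemma exists_map_eq_of_torsion_eq_one (hl : 2 ≤ l)
    (hprim : ∀ m : ℕ, ∃ ζ : k, IsPrimitiveRoot ζ (l ^ m))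
    {f : Cocycle (glAction N (endoHom k n))}
    (hf : ∀ ζ ∈ primaryTorsion k n l, f.toFun (ofTrans ζ) = 1) (σ : IntTorusEnd k n) :
    ∃ g : GL (Fin N) k,
      Matrix.GeneralLinearGroup.map (algebraMap k (RatFunField k n)) g = f.toFun σ := by
  apply exists_map_eq_of_invariant hl hprim
  intro ζ hζ
  have hmem : (fun j => ∏ i, ζ i ^ σ.mat i j) ∈ primaryTorsion k n l := by
    obtain ⟨m, hm⟩ := hζ
    refine ⟨m, funext fun j => ?_⟩
    rw [Pi.pow_apply, ← Finset.prod_pow]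
    refine Finset.prod_eq_one fun i _ => ?_
    have hi : ζ i ^ l ^ m = 1 := congrFun hm i
    rw [← zpow_natCast, ← zpow_mul, mul_comm, zpow_mul, zpow_natCast,
      hi, one_zpow]
  have h1 := congrArg f.toFun (ofTrans_mul_eq ζ σ)
  rwa [f.map_mul', f.map_mul', hf ζ hζ, hf _ hmem, one_mul, map_one, mul_one] at h1

end Trivialization

/-! ### Extension of representations to the group of fractions -/

section Fractions

open IntTorusEnd

lemma exists_smul_eq_one_tmul {A : Type*} [AddCommGroup A] (x : ℚ ⊗[ℤ] A) :
    ∃ d : ℕ, 0 < d ∧ ∃ a : A, (d : ℚ) • x = (1 : ℚ) ⊗ₜ[ℤ] a := by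
  induction x with
  | zero => exact ⟨1, one_pos, 0, by simp⟩
  | tmul q a =>
    refine ⟨q.den, q.den_pos, q.num • a, ?_⟩
    rw [TensorProduct.smul_tmul', smul_eq_mul, mul_comm, Rat.mul_den_eq_num,
      ← TensorProduct.smul_tmul, zsmul_eq_mul, mul_one]
  | add x y hx hy =>
    obtain ⟨d, hd, a, ha⟩ := hx
    obtain ⟨e, he, b, hb⟩ := hy
    refine ⟨d * e, Nat.mul_pos hd he, (e : ℤ) • a + (d : ℤ) • b, ?_⟩
    rw [TensorProduct.tmul_add, TensorProduct.tmul_smul, TensorProduct.tmul_smul, ← ha, ← hb,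
      smul_add, Nat.cast_mul]
    simp only [natCast_zsmul, ← Nat.cast_smul_eq_nsmul ℚ, smul_smul]
    rw [mul_comm (e : ℚ)]

lemma exists_common_smul_eq_one_tmul {A ι : Type*} [AddCommGroup A] [Fintype ι]
    (x : ι → ℚ ⊗[ℤ] A) :
    ∃ d : ℕ, 0 < d ∧ ∀ i, ∃ a : A, (d : ℚ) • x i = (1 : ℚ) ⊗ₜ[ℤ] a := by
  classical
  choose d hd a ha using fun i => exists_smul_eq_one_tmul (x i)
  refine ⟨∏ i, d i, Finset.prod_pos fun i _ => hd i, fun i =>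
    ⟨(∏ j ∈ Finset.univ.erase i, d j : ℕ) • a i, ?_⟩⟩
  rw [← Finset.prod_erase_mul _ _ (Finset.mem_univ i), Nat.cast_mul, ← smul_smul, ha,
    TensorProduct.tmul_smul, Nat.cast_smul_eq_nsmul]

lemma exists_common_mul_eq_intCast {ι : Type*} [Fintype ι] (q : ι → ℚ) :
    ∃ d : ℕ, 0 < d ∧ ∀ i, ∃ z : ℤ, (d : ℚ) * q i = z := by
  classical
  refine ⟨∏ i, (q i).den, Finset.prod_pos fun i _ => (q i).den_pos, fun i =>
    ⟨(∏ j ∈ Finset.univ.erase i, (q j).den : ℕ) * (q i).num, ?_⟩⟩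
  rw [← Finset.prod_erase_mul _ _ (Finset.mem_univ i), Nat.cast_mul, mul_assoc, mul_comm _ (q i),
    Rat.mul_den_eq_num]
  push_cast
  rfl

lemma exists_smul_eq_zero_of_one_tmul_eq_zero {A : Type*} [AddCommGroup A] {a : A}
    (h : (1 : ℚ) ⊗ₜ[ℤ] a = 0) : ∃ d : ℕ, 0 < d ∧ d • a = 0 := by
  have h1 : TensorProduct.mk ℤ ℚ A 1 a = 0 := h
  rw [IsLocalizedModule.eq_zero_iff (nonZeroDivisors ℤ)] at h1
  obtain ⟨c, hc⟩ := h1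
  refine ⟨(c : ℤ).natAbs, Int.natAbs_pos.2 (nonZeroDivisors.coe_ne_zero c), ?_⟩
  rw [← natCast_zsmul]
  rcases Int.natAbs_eq (c : ℤ) with h2 | h2
  · rw [← h2]
    exact hc
  · rw [← neg_eq_iff_eq_neg] at h2
    rw [← h2, neg_smul]
    exact neg_eq_zero.2 hc

variable {k : Type*} [Field k] {n : ℕ}

lemma toRat_mat_apply (a : IntTorusEnd k n) (i j : Fin n) :
    (toRat k n a).mat i j = (a.mat i j : ℚ) := rfl

lemma toRat_trans_apply (a : IntTorusEnd k n) (j : Fin n) :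
    (toRat k n a).trans j = (1 : ℚ) ⊗ₜ[ℤ] Additive.ofMul (a.trans j) := rfl

lemma toRat_ofNat_mat {s : ℕ} (hs : 0 < s) :
    ((toRat k n (ofNat k n s hs)).mat : Matrix (Fin n) (Fin n) ℚ) =
      Matrix.scalar (Fin n) (s : ℚ) := by
  ext i j
  rw [toRat_mat_apply, ofNat_mat, Matrix.scalar_apply, Matrix.scalar_apply, Matrix.diagonal_apply,
    Matrix.diagonal_apply]
  split_ifs <;> simp

lemma mul_toRat_ofNat_mat (g : RatTorusAut k n) {s : ℕ} (hs : 0 < s) (i j : Fin n) :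
    (g * toRat k n (ofNat k n s hs)).mat i j = s * g.mat i j := by
  rw [RatTorusAut.mul_mat, Units.val_mul, toRat_ofNat_mat, Matrix.scalar_apply,
    Matrix.mul_diagonal, mul_comm]

lemma mul_toRat_ofNat_trans (g : RatTorusAut k n) {s : ℕ} (hs : 0 < s) (j : Fin n) :
    (g * toRat k n (ofNat k n s hs)).trans j = (s : ℚ) • g.trans j := by
  rw [RatTorusAut.mul_trans, Pi.add_apply, toRat_trans_apply, toRat_ofNat_mat, RatTorusAut.act,
    Finset.sum_eq_single j]
  · rw [Matrix.scalar_apply, Matrix.diagonal_apply_eq]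
    simp
  · intro i _ hi
    rw [Matrix.scalar_apply, Matrix.diagonal_apply_ne _ hi, zero_smul]
  · simp

/-- Every element of the group is a fraction with a scalar as denominator. -/
lemma exists_mul_toRat_ofNat_eq (g : RatTorusAut k n) :
    ∃ (s : ℕ) (hs : 0 < s) (a : IntTorusEnd k n),
      g * toRat k n (ofNat k n s hs) = toRat k n a := by
  obtain ⟨d, hd, hz⟩ := exists_common_mul_eq_intCast fun x : Fin n × Fin n => g.mat x.1 x.2
  obtain ⟨e, he, ht⟩ := exists_common_smul_eq_one_tmul g.trans
  choose z hz using hz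
  choose t ht using ht
  have hs : 0 < e * d := Nat.mul_pos he hd
  have hmat : ((Matrix.of fun i j => (e : ℤ) * z (i, j)).map (Int.castRingHom ℚ) :
      Matrix (Fin n) (Fin n) ℚ) = (g * toRat k n (ofNat k n (e * d) hs)).mat := by
    ext i j
    rw [mul_toRat_ofNat_mat, Nat.cast_mul, mul_assoc, hz (i, j)]
    simp
  have hdet : (Matrix.of fun i j => (e : ℤ) * z (i, j)).det ≠ 0 := fun h0 => by
    have h1 := (Int.castRingHom ℚ).map_det (Matrix.of fun i j => (e : ℤ) * z (i, j))
    rw [h0, map_zero, RingHom.mapMatrix_apply, hmat] at h1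
    exact ((Matrix.isUnit_iff_isUnit_det _).1
      (g * toRat k n (ofNat k n (e * d) hs)).mat.isUnit).ne_zero h1.symm
  refine ⟨e * d, hs, ⟨Matrix.of fun i j => (e : ℤ) * z (i, j), hdet,
    fun j => (t j).toMul ^ d⟩, ?_⟩
  ext1
  · exact Units.ext hmat.symm
  · funext j
    have h1 : ((e * d : ℕ) : ℚ) • g.trans j = (d : ℚ) • (e : ℚ) • g.trans j := by
      rw [smul_smul, Nat.cast_mul, mul_comm]
    rw [mul_toRat_ofNat_trans, toRat_trans_apply, h1, ht, ofMul_pow, ofMul_toMul,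
      TensorProduct.tmul_smul, Nat.cast_smul_eq_nsmul]

lemma mul_ofNat_trans (a : IntTorusEnd k n) {s : ℕ} (hs : 0 < s) (j : Fin n) :
    (a * ofNat k n s hs).trans j = a.trans j ^ s := by
  rw [mul_trans, ofNat_mat, prod_zpow_scalar, ofNat_trans, Pi.one_apply, mul_one]

/-- The kernel of `T → T ⊗ ℚ` is torsion, hence is killed by scalars. -/
lemma exists_mul_ofNat_eq_of_toRat_eq {a b : IntTorusEnd k n} (h : toRat k n a = toRat k n b) :
    ∃ (s : ℕ) (hs : 0 < s), a * ofNat k n s hs = b * ofNat k n s hs := by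
  have hmat : a.mat = b.mat := by
    ext i j
    have h1 : (toRat k n a).mat i j = (toRat k n b).mat i j := by rw [h]
    rw [toRat_mat_apply, toRat_mat_apply] at h1
    exact_mod_cast h1
  have htors : ∀ j, ∃ d : ℕ, 0 < d ∧ (a.trans j / b.trans j) ^ d = 1 := by
    intro j
    have h1 : (toRat k n a).trans j = (toRat k n b).trans j := by rw [h]
    rw [toRat_trans_apply, toRat_trans_apply, ← sub_eq_zero, ← TensorProduct.tmul_sub,
      ← ofMul_div] at h1
    obtain ⟨d, hd, hd'⟩ := exists_smul_eq_zero_of_one_tmul_eq_zero h1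
    exact ⟨d, hd, Additive.ofMul.injective hd'⟩
  choose d hd hd' using htors
  refine ⟨∏ j, d j, Finset.prod_pos fun j _ => hd j, ?_⟩
  ext1
  · rw [mul_mat, mul_mat, hmat]
  · funext j
    rw [mul_ofNat_trans, mul_ofNat_trans, ← div_eq_one, ← div_pow]
    obtain ⟨c, hc⟩ := Finset.dvd_prod_of_mem d (Finset.mem_univ j)
    rw [hc, pow_mul, hd', one_pow]

lemma ofNat_mul_ofNat {s s' : ℕ} (hs : 0 < s) (hs' : 0 < s') :
    ofNat k n s hs * ofNat k n s' hs' = ofNat k n (s * s') (Nat.mul_pos hs hs') := by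
  ext1
  · rw [mul_mat, ofNat_mat, ofNat_mat, ofNat_mat, ← map_mul, Nat.cast_mul]
  · funext j
    rw [mul_ofNat_trans, ofNat_trans, ofNat_trans, Pi.one_apply, one_pow]

lemma ofNat_one : ofNat k n 1 one_pos = 1 := by
  ext1
  · rw [ofNat_mat, Nat.cast_one, map_one, one_mat]
  · rfl

/-- Scalars satisfy the Ore condition. -/
lemma exists_mul_ofNat_eq_ofNat_mul (a : IntTorusEnd k n) {s : ℕ} (hs : 0 < s) :
    ∃ a', a * ofNat k n s hs = ofNat k n s hs * a' := by
  refine ⟨⟨a.mat, a.det_ne_zero, a.trans ^ s⟩, ?_⟩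
  ext1
  · rw [mul_mat, mul_mat]
    exact ((Matrix.scalar_commute _ (fun _ => Commute.all _ _) a.mat).eq).symm
  · funext j
    rw [mul_ofNat_trans, mul_trans, ofNat_trans]
    simp

/-- A homomorphism from the monoid to a group extends to the group of fractions. -/
lemma exists_extension {G : Type*} [Group G] (ρ : IntTorusEnd k n →* G) :
    ∃ ρ' : RatTorusAut k n →* G, ∀ a, ρ' (toRat k n a) = ρ a := by
  have hker : ∀ a b, toRat k n a = toRat k n b → ρ a = ρ b := by
    intro a b h
    obtain ⟨s, hs, h1⟩ := exists_mul_ofNat_eq_of_toRat_eq h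
    have h2 := congrArg ρ h1
    rw [map_mul, map_mul] at h2
    exact mul_right_cancel h2
  choose s hs a ha using exists_mul_toRat_ofNat_eq (k := k) (n := n)
  have hcomm : ∀ {r r' : ℕ} (hr : 0 < r) (hr' : 0 < r'),
      ofNat k n r hr * ofNat k n r' hr' = ofNat k n r' hr' * ofNat k n r hr := by
    intro r r' hr hr'
    rw [ofNat_mul_ofNat, ofNat_mul_ofNat]
    congr 1
    exact mul_comm r r'
  have hwd : ∀ (g : RatTorusAut k n) (r : ℕ) (hr : 0 < r) (b : IntTorusEnd k n),
      g * toRat k n (ofNat k n r hr) = toRat k n b →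
      ρ (a g) * (ρ (ofNat k n (s g) (hs g)))⁻¹ = ρ b * (ρ (ofNat k n r hr))⁻¹ := by
    intro g r hr b hb
    have h1 : toRat k n (a g * ofNat k n r hr) = toRat k n (b * ofNat k n (s g) (hs g)) := by
      rw [map_mul, map_mul, ← ha, ← hb, mul_assoc, mul_assoc, ← map_mul, ← map_mul, hcomm]
    have h2 := hker _ _ h1
    have h3 := congrArg ρ (hcomm (hs g) hr)
    rw [map_mul, map_mul] at h2 h3
    calc ρ (a g) * (ρ (ofNat k n (s g) (hs g)))⁻¹
        = ρ (a g) * ρ (ofNat k n r hr) *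
            (ρ (ofNat k n (s g) (hs g)) * ρ (ofNat k n r hr))⁻¹ := by group
      _ = ρ b * ρ (ofNat k n (s g) (hs g)) *
            (ρ (ofNat k n r hr) * ρ (ofNat k n (s g) (hs g)))⁻¹ := by rw [h2, h3]
      _ = ρ b * (ρ (ofNat k n r hr))⁻¹ := by group
  have hone : ∀ b, ρ (a (toRat k n b)) *
      (ρ (ofNat k n (s (toRat k n b)) (hs (toRat k n b))))⁻¹ = ρ b := by
    intro b
    rw [hwd (toRat k n b) 1 one_pos b (by rw [ofNat_one, map_one, mul_one]), ofNat_one, map_one,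
      inv_one, mul_one]
  refine ⟨⟨⟨fun g => ρ (a g) * (ρ (ofNat k n (s g) (hs g)))⁻¹, ?_⟩, fun g g' => ?_⟩, hone⟩
  · have h1 := hone 1
    rwa [map_one, map_one] at h1
  · obtain ⟨c, hc⟩ := exists_mul_ofNat_eq_ofNat_mul (a g') (hs g)
    change ρ (a (g * g')) * (ρ (ofNat k n (s (g * g')) (hs (g * g'))))⁻¹ =
      ρ (a g) * (ρ (ofNat k n (s g) (hs g)))⁻¹ * (ρ (a g') * (ρ (ofNat k n (s g') (hs g')))⁻¹)
    rw [hwd (g * g') (s g' * s g) (Nat.mul_pos (hs g') (hs g)) (a g * c),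
      ← ofNat_mul_ofNat (hs g') (hs g)]
    · have h1 := congrArg ρ hc
      rw [map_mul, map_mul, ← inv_mul_eq_iff_eq_mul] at h1
      rw [map_mul, map_mul, ← h1]
      group
    · rw [← ofNat_mul_ofNat (hs g') (hs g), map_mul, mul_assoc, ← mul_assoc g', ha, ← map_mul, hc,
        map_mul, ← mul_assoc, ha, map_mul]

end Fractions

/-! ### The comparison map is bijective -/

section Comparison

open IntTorusEnd

variable {k : Type*} [Field k] {n N l : ℕ}

lemma glAction_map (σ : IntTorusEnd k n) (g : GL (Fin N) k) :
    glAction N (endoHom k n) σ (Matrix.GeneralLinearGroup.map (algebraMap k (RatFunField k n)) g) =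
      Matrix.GeneralLinearGroup.map (algebraMap k (RatFunField k n)) g := by
  ext i j
  rw [glAction_apply]
  exact (endoHom k n σ).commutes (g i j)

lemma glMap_injective : Function.Injective
    (Matrix.GeneralLinearGroup.map (n := Fin N) (algebraMap k (RatFunField k n))) := fun _ _ h =>
  Units.ext (Matrix.map_injective (algebraMap k (RatFunField k n)).injective (congrArg Units.val h))

lemma toRat_ofTrans_eq_one (hl : 2 ≤ l) {ζ : Fin n → kˣ} (hζ : ζ ∈ primaryTorsion k n l) :
    toRat k n (ofTrans ζ) = 1 := by
  obtain ⟨m, hm⟩ := hζ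
  have hs : 0 < l ^ m := pow_pos (by omega) m
  have h1 := congrArg (toRat k n) (ofTrans_mul_ofNat ζ hs)
  rwa [hm, ofTrans_one, mul_one, map_mul, mul_eq_right] at h1

lemma comparison_surjective [CharZero k] (hl : 2 ≤ l)
    (hprim : ∀ m : ℕ, ∃ ζ : k, IsPrimitiveRoot ζ (l ^ m)) :
    Function.Surjective (comparison k n N) := by
  intro x
  induction x using Quotient.inductionOn with
  | h f =>
  obtain ⟨b, hb⟩ := exists_twist_torsion_eq_one hl hprim f
  choose g hg using exists_map_eq_of_torsion_eq_one hl hprim hb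
  let ρ : IntTorusEnd k n →* GL (Fin N) k :=
    { toFun := g
      map_one' := glMap_injective (by rw [hg, Cocycle.map_one, map_one])
      map_mul' := fun σ τ => glMap_injective (by
        rw [hg, Cocycle.map_mul', map_mul, hg σ, ← hg τ, glAction_map]) }
  obtain ⟨ρ', hρ'⟩ := exists_extension ρ
  refine ⟨Quotient.mk _ ⟨ρ', fun σ τ => map_mul ρ' σ τ⟩, Quotient.sound ⟨b, fun σ => ?_⟩⟩
  change Matrix.GeneralLinearGroup.map _ (ρ' (toRat k n σ)) = _
  rw [hρ']
  exact hg σ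

lemma comparison_injective (hl : 2 ≤ l)
    (hprim : ∀ m : ℕ, ∃ ζ : k, IsPrimitiveRoot ζ (l ^ m)) :
    Function.Injective (comparison k n N) := by
  intro x y h
  induction x using Quotient.inductionOn with
  | h f =>
  induction y using Quotient.inductionOn with
  | h f' =>
  obtain ⟨b, hb⟩ := Quotient.exact h
  change ∀ σ, Matrix.GeneralLinearGroup.map (algebraMap k (RatFunField k n))
      (f.toFun (toRat k n σ)) = b⁻¹ * Matrix.GeneralLinearGroup.map
      (algebraMap k (RatFunField k n)) (f'.toFun (toRat k n σ)) *
        glAction N (endoHom k n) σ b at hb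
  obtain ⟨c, rfl⟩ := exists_map_eq_of_invariant hl hprim (b := b) fun ζ hζ => by
    have h1 := hb (ofTrans ζ)
    rw [toRat_ofTrans_eq_one hl hζ, f.map_one, f'.map_one, map_one, mul_one] at h1
    exact (inv_mul_eq_one.1 h1.symm).symm
  have hc : ∀ σ, f.toFun (toRat k n σ) = c⁻¹ * f'.toFun (toRat k n σ) * c := fun σ =>
    glMap_injective (by rw [hb, glAction_map, map_mul, map_mul, map_inv])
  refine Quotient.sound ⟨c, fun g => ?_⟩
  change f.toFun g = c⁻¹ * f'.toFun g * c
  obtain ⟨s, hs, a, ha⟩ := exists_mul_toRat_ofNat_eq g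
  have h1 : f.toFun g * f.toFun (toRat k n (ofNat k n s hs)) = f.toFun (toRat k n a) := by
    rw [← ha]
    exact (f.map_mul' _ _).symm
  have h2 : f'.toFun g * f'.toFun (toRat k n (ofNat k n s hs)) = f'.toFun (toRat k n a) := by
    rw [← ha]
    exact (f'.map_mul' _ _).symm
  rw [hc, hc, ← h2] at h1
  rw [← mul_inv_eq_iff_eq_mul.2 h1.symm]
  group

end Comparison

end TorusCohomology

theorem mainTheorem4 {k : Type*} [Field k] [CharZero k]
    (hk : ∃ l : ℕ, 2 ≤ l ∧ ∀ m : ℕ, ∃ ζ : k, IsPrimitiveRoot ζ (l ^ m)) (n N : ℕ) :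
    Function.Bijective (TorusCohomology.comparison k n N) := by
  obtain ⟨l, hl, hprim⟩ := hk
  exact ⟨TorusCohomology.comparison_injective hl hprim,
    TorusCohomology.comparison_surjective hl hprim⟩
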